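/- **Setting.** A power grid has one conventional generator, $N$ renewable generators with on-site storage, base and flexible loads, and access to external energy markets; time is $t=0,1,2,\dots$. The system state of slot $t$ is $\mathbf q_t=[\mathbf a_t,l_{b,t},l_{f,t},p_{b,t},p_{s,t}]$ with renewable generation $a_{i,t}\in[0,a_{i,\max}]$, base loads $l_{b,t}\in[l_{b,\min},l_{b,\max}]$, flexible loads $l_{f,t}\in[l_{f,\min},l_{f,\max}]$, $l_{f,t}>0$, and unit buying and selling prices $p_{b,t}\in[p_{b,\min},p_{b,\max}]$, $p_{s,t}\in[p_{s,\min},p_{s,\max}]$, where $p_{s,\min}\ge 0$ and $p_{b,t}>p_{s,t}$. The action $\mathbf u_t=[\mathbf b_t,\mathbf x_t,l_{m,t},g_t,e_{b,t},e_{s,t}]$ has cost $$w_t=C(g_t)+p_{b,t}e_{b,t}-p_{s,t}e_{s,t}+\sum_{i=1}^N D_i(x_{i,t}),$$ where $C$ on $[0,g_{\max}]$ and $D_i$ on $[x_{i,\min},x_{i,\max}]$ (with $x_{i,\min}<0<x_{i,\max}$) are convex and continuously differentiable with derivatives at most $C'_{\max}$ and $D'_{i,\max}$. The constraints of slot $t$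 are: $l_{b,t}\le l_{m,t}\le l_{b,t}+l_{f,t}$; $x_{i,\min}\le x_{i,t}\le x_{i,\max}$; $b_{i,t}=a_{i,t}-x_{i,t}\ge 0$; $0\le g_t\le g_{\max}$; the ramping constraint $|g_t-g_{t-1}|\le r g_{\max}$, $r\in[0,1]$; $e_{b,t},e_{s,t}\ge 0$; and $g_t+e_{b,t}+\sum_i b_{i,t}=e_{s,t}+l_{m,t}$. The energy states evolve by $s_{i,t+1}=s_{i,t}+x_{i,t}$. The initial energy states $s_{i,0}\in[s_{i,\min},s_{i,\max}]$ and the initial output $g_{-1}\in[0,g_{\max}]$ are given. **Problem P1.** $w^{\rm opt}(r)$ is the infimum of $\limsup_{T\to\infty}\frac1T\sum_{t=0}^{T-1}\mathbb E[w_t]$ over all causal, possibly randomized, action processes that satisfy in every slot the constraints above and $s_{i,\min}\le s_{i,t}\le s_{i,\max}$, and moreover $$\limsup_{T\to\infty}\frac1T\sum_{t=0}^{T-1}\mathbb E\Big[\frac{l_{b,t}+l_{f,t}-l_{m,t}}{l_{f,t}}\Big]\le\alpha,\qquad \alpha\in[0,1].$$ **Algorithm 1.** Let $V>0$ and $\beta_i=V(p_{b,\max}+D'_{i,\max})-x_{i,\min}+s_{i,\min}$.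 Start with $J_0=0$. In each slot, observe $\mathbf q_t$, $s_{i,t}$, $J_t$, take an action $\mathbf u_t$ that minimizes $$\sum_{i=1}^N\big[VD_i(x_{i,t})+(s_{i,t}-\beta_i)x_{i,t}\big]+VC(g_t)+Vp_{b,t}e_{b,t}-Vp_{s,t}e_{s,t}-\frac{J_t}{l_{f,t}}l_{m,t}$$ under the constraints of the slot (including the ramping constraint), and update $s_{i,t}$ as above and $J_{t+1}=\max\{J_t-\alpha,0\}+\frac{l_{b,t}+l_{f,t}-l_{m,t}}{l_{f,t}}$. Let $w^*(r,V)$ be the resulting value of $\limsup_{T\to\infty}\frac1T\sum_{t=0}^{T-1}\mathbb E[w_t]$. **Theorem.** Assume that the system states $\mathbf q_t$ are i.i.d. over time, and let $B=\frac12(1+\alpha^2)+\frac12\sum_{i=1}^N\max\{x_{i,\min}^2,x_{i,\max}^2\}$. Then, for all $r\in[0,1]$ and $V>0$, and whichever minimizers Algorithm 1 takes, 1. $w^*(r,V)-w^{\rm opt}(r)\le(1-r)\,g_{\max}\max\{p_{b,\max},C'_{\max}\}+B/V$; 2. $w^{\rm opt}(r)\ge w^*(1,V)-B/V$. -/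

import Mathlib

open MeasureTheory ProbabilityTheory Filter Set

noncomputable section

namespace PowerGrid

/-- The parameters of a power grid with one conventional generator, `N` renewable generators with
on-site storage, base and flexible loads, and external energy markets. -/
structure Grid (N : ℕ) where
  /-- range of the requested base loads -/
  lbMin : ℝ
  lbMax : ℝ
  /-- range of the requested flexible loads -/
  lfMin : ℝ
  lfMax : ℝ
  /-- tolerated long-run portion of unsatisfied flexible loads -/
  α : ℝ
  α_mem : α ∈ Icc (0 : ℝ) 1
  /-- maximum renewable generation amounts -/
  aMax : Fin N → ℝ
  /-- `|xMin i|` is the maximum discharging amount, `xMax i` the maximum charging amount -/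
  xMin : Fin N → ℝ
  xMax : Fin N → ℝ
  xMin_neg : ∀ i, xMin i < 0
  xMax_pos : ∀ i, 0 < xMax i
  /-- allowed range of the energy state of each storage unit -/
  sMin : Fin N → ℝ
  sMax : Fin N → ℝ
  /-- degradation cost functions -/
  D : Fin N → ℝ → ℝ
  D_contDiff : ∀ i, ContDiffOn ℝ 1 (D i) (Icc (xMin i) (xMax i))
  D_convex : ∀ i, ConvexOn ℝ (Icc (xMin i) (xMax i)) (D i)
  /-- upper bounds of the derivatives of the degradation costs -/
  dD_max : Fin N → ℝ
  dD_le : ∀ i, ∀ x ∈ Icc (xMin i) (xMax i), derivWithin (D i) (Icc (xMin i) (xMax i)) x ≤ dD_max i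
  /-- maximum output of the conventional generator -/
  gMax : ℝ
  gMax_nonneg : 0 ≤ gMax
  /-- generation cost function -/
  C : ℝ → ℝ
  C_contDiff : ContDiffOn ℝ 1 C (Icc 0 gMax)
  C_convex : ConvexOn ℝ (Icc 0 gMax) C
  /-- upper bound of the derivative of the generation cost -/
  dC_max : ℝ
  dC_le : ∀ g ∈ Icc 0 gMax, derivWithin C (Icc 0 gMax) g ≤ dC_max
  /-- ranges of the unit buying price and of the unit selling price; prices are nonnegative -/
  pbMin : ℝ
  pbMax : ℝ
  psMin : ℝ
  psMax : ℝ
  psMin_nonneg : 0 ≤ psMin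

/-- System state of one slot: renewable generation amounts, base loads, flexible loads, buying
price, selling price. -/
abbrev State (N : ℕ) : Type := (Fin N → ℝ) × ℝ × ℝ × ℝ × ℝ

namespace State

variable {N : ℕ}

/-- renewable generation amounts -/
def a (q : State N) : Fin N → ℝ := q.1
/-- requested base loads -/
def lb (q : State N) : ℝ := q.2.1
/-- requested flexible loads -/
def lf (q : State N) : ℝ := q.2.2.1
/-- unit buying price -/
def pb (q : State N) : ℝ := q.2.2.2.1
/-- unit selling price -/
def ps (q : State N) : ℝ := q.2.2.2.2

end State

/-- Control action of one slot: contributed energy amounts, charging/discharging amounts, satisfied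
loads, output of the conventional generator, energy bought, energy sold. -/
abbrev Action (N : ℕ) : Type := (Fin N → ℝ) × (Fin N → ℝ) × ℝ × ℝ × ℝ × ℝ

namespace Action

variable {N : ℕ}

/-- energy contributed by the renewable generators -/
def b (u : Action N) : Fin N → ℝ := u.1
/-- charging (positive) or discharging (negative) amounts -/
def x (u : Action N) : Fin N → ℝ := u.2.1
/-- satisfied loads -/
def lm (u : Action N) : ℝ := u.2.2.1
/-- output of the conventional generator -/
def g (u : Action N) : ℝ := u.2.2.2.1
/-- energy bought from the external markets -/
def eb (u : Action N) : ℝ := u.2.2.2.2.1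
/-- energy sold to the external markets -/
def es (u : Action N) : ℝ := u.2.2.2.2.2

end Action

variable {N : ℕ} {Ω : Type*}

/-- The values that a system state may take. The flexible loads are positive (the portion of
unsatisfied flexible loads is a quotient by them) and the buying price exceeds the selling price. -/
structure Grid.ValidState (G : Grid N) (q : State N) : Prop where
  a_mem : ∀ i, q.a i ∈ Icc 0 (G.aMax i)
  lb_mem : q.lb ∈ Icc G.lbMin G.lbMax
  lf_mem : q.lf ∈ Icc G.lfMin G.lfMax
  lf_pos : 0 < q.lf
  pb_mem : q.pb ∈ Icc G.pbMin G.pbMax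
  ps_mem : q.ps ∈ Icc G.psMin G.psMax
  ps_lt_pb : q.ps < q.pb

/-- The system cost of one slot. -/
def Grid.cost (G : Grid N) (q : State N) (u : Action N) : ℝ :=
  G.C u.g + q.pb * u.eb - q.ps * u.es + ∑ i, G.D i (u.x i)

/-- The portion of unsatisfied flexible loads in one slot. -/
def unsatisfied (q : State N) (u : Action N) : ℝ := (q.lb + q.lf - u.lm) / q.lf

/-- The constraints on the action of a single slot, with ramping coefficient `r`, system state `q`
and output `gPrev` of the conventional generator in the previous slot. -/
structure Grid.SlotFeasible (G : Grid N) (r : ℝ) (q : State N) (gPrev : ℝ) (u : Action N) :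
    Prop where
  loads : q.lb ≤ u.lm ∧ u.lm ≤ q.lb + q.lf
  charging : ∀ i, G.xMin i ≤ u.x i ∧ u.x i ≤ G.xMax i
  contribution : ∀ i, u.b i = q.a i - u.x i ∧ 0 ≤ u.b i
  output : 0 ≤ u.g ∧ u.g ≤ G.gMax
  ramping : |u.g - gPrev| ≤ r * G.gMax
  bought : 0 ≤ u.eb
  sold : 0 ≤ u.es
  balance : u.g + u.eb + ∑ i, u.b i = u.es + u.lm

/-- The output of the conventional generator in the slot before `t`; `gInit` is its output before
slot `0`. -/
def prevOutput (gInit : ℝ) (u : ℕ → Action N) : ℕ → ℝ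
  | 0 => gInit
  | t + 1 => (u t).g

/-- The energy states of the storage units along a sequence of actions, started at `s0`. -/
def energyState (s0 : Fin N → ℝ) (u : ℕ → Action N) : ℕ → Fin N → ℝ
  | 0 => s0
  | t + 1 => fun i => energyState s0 u t i + (u t).x i

/-- The virtual queue backlog `J` along sequences of system states and actions, with `J 0 = 0`. -/
def Grid.backlog (G : Grid N) (q : ℕ → State N) (u : ℕ → Action N) : ℕ → ℝ
  | 0 => 0
  | t + 1 => max (G.backlog q u t - G.α) 0 + unsatisfied (q t) (u t)

/-- The superior limit of the time averages of a real sequence (an extended real number). -/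
def longRunAverage (f : ℕ → ℝ) : EReal :=
  limsup (fun T : ℕ => (((1 / (T : ℝ)) * ∑ t ∈ Finset.range T, f t : ℝ) : EReal)) atTop

/-- The random environment of the grid: system states that are independent and identically
distributed over time, and an initial condition.

`𝓗 t` is the information available just before the system state `q t` of slot `t` is revealed: it
contains the initial condition, the earlier system states and whatever has been used to randomize
earlier actions. The information `𝓗 (t + 1)` available after slot `t` contains `q t` and the
random numbers used in slot `t`, but it tells nothing about `q (t + 1)`. -/
structure Grid.IIDEnvironment (G : Grid N) [mΩ : MeasurableSpace Ω] (μ : Measure Ω)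
    (𝓗 : Filtration ℕ mΩ) (q : ℕ → Ω → State N) (s0 : Ω → Fin N → ℝ) (gInit : Ω → ℝ) : Prop where
  state_measurable : ∀ t, Measurable[𝓗 (t + 1)] (q t)
  state_valid : ∀ t, ∀ᵐ ω ∂μ, G.ValidState (q t ω)
  state_iIndep : iIndepFun q μ
  state_identDistrib : ∀ t, IdentDistrib (q t) (q 0) μ μ
  state_indep_past : ∀ t, Indep (MeasurableSpace.comap (q t) inferInstance) (𝓗 t) μ
  init_energy_measurable : Measurable[𝓗 0] s0
  init_energy_mem : ∀ᵐ ω ∂μ, ∀ i, s0 ω i ∈ Icc (G.sMin i) (G.sMax i)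
  init_output_measurable : Measurable[𝓗 0] gInit
  init_output_mem : ∀ᵐ ω ∂μ, gInit ω ∈ Icc 0 G.gMax

variable [mΩ : MeasurableSpace Ω]

/-- The long-run average expected system cost of an action process. -/
def Grid.longRunCost (G : Grid N) (μ : Measure Ω) (q : ℕ → Ω → State N)
    (u : ℕ → Ω → Action N) : EReal :=
  longRunAverage fun t => ∫ ω, G.cost (q t ω) (u t ω) ∂μ

/-- Feasibility of a (causal, possibly randomized) action process for the power balancing problem
with ramping coefficient `r`. The system cost of a slot is bounded below under the constraints, so
that the integrability requirement excludes only processes whose expected cost is `+∞`. -/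
structure Grid.Feasible (G : Grid N) (μ : Measure Ω) (𝓗 : Filtration ℕ mΩ)
    (q : ℕ → Ω → State N) (s0 : Ω → Fin N → ℝ) (gInit : Ω → ℝ) (r : ℝ)
    (u : ℕ → Ω → Action N) : Prop where
  causal : ∀ t, Measurable[𝓗 (t + 1)] (u t)
  cost_integrable : ∀ t, Integrable (fun ω => G.cost (q t ω) (u t ω)) μ
  slot : ∀ t, ∀ᵐ ω ∂μ, G.SlotFeasible r (q t ω) (prevOutput (gInit ω) (fun k => u k ω) t) (u t ω)
  energy_mem : ∀ t, ∀ᵐ ω ∂μ, ∀ i,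
    energyState (s0 ω) (fun k => u k ω) t i ∈ Icc (G.sMin i) (G.sMax i)
  quality : longRunAverage (fun t => ∫ ω, unsatisfied (q t ω) (u t ω) ∂μ) ≤ (G.α : EReal)

/-- The optimal value of the power balancing problem with ramping coefficient `r`. -/
def Grid.optCost (G : Grid N) (μ : Measure Ω) (𝓗 : Filtration ℕ mΩ)
    (q : ℕ → Ω → State N) (s0 : Ω → Fin N → ℝ) (gInit : Ω → ℝ) (r : ℝ) : EReal :=
  ⨅ u ∈ {u : ℕ → Ω → Action N | G.Feasible μ 𝓗 q s0 gInit r u}, G.longRunCost μ q u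

/-- The perturbation parameters of the real-time algorithm. -/
def Grid.β (G : Grid N) (V : ℝ) (i : Fin N) : ℝ :=
  V * (G.pbMax + G.dD_max i) - G.xMin i + G.sMin i

/-- The objective of the optimization problem that the real-time algorithm solves in one slot, with
energy states `s`, backlog `J` and system state `q`. -/
def Grid.slotObjective (G : Grid N) (V : ℝ) (s : Fin N → ℝ) (J : ℝ) (q : State N) (u : Action N) :
    ℝ :=
  (∑ i, (V * G.D i (u.x i) + (s i - G.β V i) * u.x i)) + V * G.C u.g
    + V * q.pb * u.eb - V * q.ps * u.es - J / q.lf * u.lm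

/-- `u` is an optimal solution of the optimization problem of one slot. -/
def Grid.SolvesSlot (G : Grid N) (r V : ℝ) (s : Fin N → ℝ) (J : ℝ) (q : State N) (gPrev : ℝ)
    (u : Action N) : Prop :=
  G.SlotFeasible r q gPrev u ∧
    ∀ u', G.SlotFeasible r q gPrev u' → G.slotObjective V s J q u ≤ G.slotObjective V s J q u'

/-- `u` is a process of actions taken by the real-time algorithm with ramping coefficient `r` and
control parameter `V`: in each slot, after observing the system state, the energy states and the
backlog, it takes some optimal solution of the problem of the slot. -/
structure Grid.IsAlgorithmRun (G : Grid N) (μ : Measure Ω) (𝓗 : Filtration ℕ mΩ)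
    (q : ℕ → Ω → State N) (s0 : Ω → Fin N → ℝ) (gInit : Ω → ℝ) (r V : ℝ)
    (u : ℕ → Ω → Action N) : Prop where
  causal : ∀ t, Measurable[𝓗 (t + 1)] (u t)
  solves : ∀ t, ∀ᵐ ω ∂μ,
    G.SolvesSlot r V (energyState (s0 ω) (fun k => u k ω) t)
      (G.backlog (fun k => q k ω) (fun k => u k ω) t) (q t ω)
      (prevOutput (gInit ω) (fun k => u k ω) t) (u t ω)

/-- The constant `B` of the performance bound. -/
def Grid.B (G : Grid N) : ℝ :=
  1 / 2 * (1 + G.α ^ 2) + 1 / 2 * ∑ i, max (G.xMin i ^ 2) (G.xMax i ^ 2)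

end PowerGrid

end

namespace PowerGrid

variable {N : ℕ}

/-! The method is Lyapunov drift plus penalty. The drift of `lyapunov` over one slot, plus `V` times
the cost, is at most `B - α J + driftPenalty`, and the algorithm minimizes `driftPenalty` over the
actions permitted in the slot. It remains to produce a good competitor and to handle ramping.

Competitor. No optimal stationary policy is constructed. Given a feasible process `v` and a slot
`k`, sample an action in slot `t` from the conditional law of `v k` given `q k`, evaluated at `q t`.
Since `q t` has the law of `q k` and is independent of the energy states and the backlog,
expectations of products factor, and the bound involves only the expected cost, charging and
unsatisfied portion of `v` in slot `k` (`integral_driftPenalty_le`). Now fix `t` and average over `k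
< K`: the charging amounts telescope inside the storage range, so their average vanishes; the
unsatisfied portions average to at most `α`, which absorbs `-α J`; the costs average to the long-run
cost of `v`. Summing the result over `t` telescopes the Lyapunov function.

Ramping. A sampled output may be out of reach. Moving it into reach and trading the difference costs
at most `(1 - r) gMax max {pbMax, dC_max}` (`exists_slotFeasible_driftPenalty_le`). As `C` may
decrease, and its derivative has no given lower bound, this is used only when the previous output
lies above the least minimizer `g₀` of `C`. For `r > 0` the algorithm itself brings the output there
in finitely many slots, which do not affect the long-run average. For `r = r' = 0` all outputs equal
`gInit`, the generation cost is the same for both processes, and `C` may be replaced by `0`. -/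

/-! ### Actions of a single slot: optimality and adaptation to ramping. -/

lemma Grid.C_sub_le (G : Grid N) {g g' : ℝ} (hg : g ∈ Icc 0 G.gMax) (hg' : g' ∈ Icc 0 G.gMax)
    (h : g ≤ g') : G.C g' - G.C g ≤ G.dC_max * (g' - g) := by
  have hd : ∀ x ∈ interior (Icc 0 G.gMax), DifferentiableAt ℝ G.C x := fun x hx =>
    (G.C_contDiff.differentiableOn (by simp)).differentiableAt (mem_interior_iff_mem_nhds.1 hx)
  refine (convex_Icc 0 G.gMax).image_sub_le_mul_sub_of_deriv_le G.C_contDiff.continuousOn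
    (fun x hx => (hd x hx).differentiableWithinAt) (fun x hx => ?_) g hg g' hg' h
  rw [← derivWithin_of_mem_nhds (mem_interior_iff_mem_nhds.1 hx)]
  exact G.dC_le x (interior_subset hx)

/-- The quantity that bounds the drift plus penalty; it differs from the objective of the slot
by a term that does not depend on the action. -/
noncomputable def Grid.driftPenalty (G : Grid N) (V : ℝ) (s : Fin N → ℝ) (J : ℝ) (q : State N)
    (u : Action N) : ℝ :=
  V * G.cost q u + ∑ i, (s i - G.β V i) * u.x i + J * unsatisfied q u

lemma Grid.slotObjective_eq (G : Grid N) (V : ℝ) (s : Fin N → ℝ) (J : ℝ) (q : State N)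
    (u : Action N) :
    G.slotObjective V s J q u = G.driftPenalty V s J q u - J * ((q.lb + q.lf) / q.lf) := by
  simp only [Grid.slotObjective, Grid.driftPenalty, Grid.cost, unsatisfied, Finset.sum_add_distrib,
    ← Finset.mul_sum]
  ring

lemma Grid.SolvesSlot.driftPenalty_le {G : Grid N} {r V : ℝ} {s : Fin N → ℝ} {J : ℝ} {q : State N}
    {gPrev : ℝ} {u v : Action N} (h : G.SolvesSlot r V s J q gPrev u)
    (hv : G.SlotFeasible r q gPrev v) :
    G.driftPenalty V s J q u ≤ G.driftPenalty V s J q v := by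
  have := h.2 v hv
  rw [G.slotObjective_eq, G.slotObjective_eq] at this
  linarith

lemma Grid.SlotFeasible.unsatisfied_mem {G : Grid N} {r : ℝ} {q : State N} {gPrev : ℝ}
    {u : Action N} (h : G.SlotFeasible r q gPrev u) (hq : G.ValidState q) :
    unsatisfied q u ∈ Icc (0 : ℝ) 1 := by
  obtain ⟨h1, h2⟩ := h.loads
  have := hq.lf_pos
  refine ⟨div_nonneg (by linarith) this.le, ?_⟩
  rw [unsatisfied, div_le_one this]
  linarith

/-- The action obtained from `u` by changing the generator output and the traded amounts. -/
def Action.trade (u : Action N) (g eb es : ℝ) : Action N := (u.b, u.x, u.lm, g, eb, es)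

lemma Grid.SlotFeasible.trade {G : Grid N} {r r' : ℝ} {q : State N} {gPrev gPrev' : ℝ}
    {u : Action N} (h : G.SlotFeasible r q gPrev u) {g eb es : ℝ} (hg : 0 ≤ g ∧ g ≤ G.gMax)
    (hr : |g - gPrev'| ≤ r' * G.gMax) (heb : 0 ≤ eb) (hes : 0 ≤ es)
    (hbal : g + eb - es = u.g + u.eb - u.es) :
    G.SlotFeasible r' q gPrev' (u.trade g eb es) where
  loads := h.loads
  charging := h.charging
  contribution := h.contribution
  output := hg
  ramping := hr
  bought := heb
  sold := hes
  balance := by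
    have := h.balance
    change g + eb + ∑ i, u.b i = es + u.lm
    linarith

lemma Grid.driftPenalty_trade (G : Grid N) (V : ℝ) (s : Fin N → ℝ) (J : ℝ) (q : State N)
    (u : Action N) (g eb es : ℝ) :
    G.driftPenalty V s J q (u.trade g eb es) = G.driftPenalty V s J q u
      + V * ((G.C g - G.C u.g) + q.pb * (eb - u.eb) - q.ps * (es - u.es)) := by
  have h1 : (u.trade g eb es).x = u.x := rfl
  have h2 : (u.trade g eb es).lm = u.lm := rfl
  have h3 : (u.trade g eb es).g = g := rfl
  have h4 : (u.trade g eb es).eb = eb := rfl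
  have h5 : (u.trade g eb es).es = es := rfl
  simp only [Grid.driftPenalty, Grid.cost, unsatisfied, h1, h2, h3, h4, h5]
  ring

lemma Grid.ValidState.ps_nonneg {G : Grid N} {q : State N} (h : G.ValidState q) : 0 ≤ q.ps :=
  G.psMin_nonneg.trans h.ps_mem.1

lemma Grid.ValidState.pb_pos {G : Grid N} {q : State N} (h : G.ValidState q) : 0 < q.pb :=
  h.ps_nonneg.trans_lt h.ps_lt_pb

/-- An optimal action never buys and sells in the same slot. -/
lemma Grid.SolvesSlot.eb_eq_zero_or {G : Grid N} {r V : ℝ} {s : Fin N → ℝ} {J : ℝ} {q : State N}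
    {gPrev : ℝ} {u : Action N} (h : G.SolvesSlot r V s J q gPrev u) (hV : 0 < V)
    (hq : G.ValidState q) : u.eb = 0 ∨ u.es = 0 := by
  -- Cancelling `m` from both trades keeps the balance and saves `V m (pb - ps)`.
  set m := min u.eb u.es with hm
  have hm0 : 0 ≤ m := le_min h.1.bought h.1.sold
  rcases hm0.eq_or_lt with h0 | h0
  · rcases min_choice u.eb u.es with h' | h'
    · left; rw [← h', ← hm, ← h0]
    · right; rw [← h', ← hm, ← h0]
  · exfalso
    have hf : G.SlotFeasible r q gPrev (u.trade u.g (u.eb - m) (u.es - m)) :=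
      h.1.trade h.1.output h.1.ramping (by linarith [min_le_left u.eb u.es])
        (by linarith [min_le_right u.eb u.es]) (by ring)
    have := h.driftPenalty_le hf
    rw [G.driftPenalty_trade] at this
    have hp : 0 < V * (m * (q.pb - q.ps)) :=
      mul_pos hV (mul_pos h0 (by linarith [hq.ps_lt_pb]))
    nlinarith

/-- While generation becomes cheaper with growing output, an optimal action raises the output as
much as the ramping constraint permits. -/
lemma Grid.SolvesSlot.min_le_output {G : Grid N} {r V : ℝ} {s : Fin N → ℝ} {J : ℝ} {q : State N}
    {gPrev : ℝ} {u : Action N} (h : G.SolvesSlot r V s J q gPrev u) (hV : 0 < V)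
    (hq : G.ValidState q) {g₀ : ℝ} (hg₀ : g₀ ≤ G.gMax)
    (hC : StrictAntiOn G.C (Icc 0 g₀)) : min g₀ (gPrev + r * G.gMax) ≤ u.g := by
  by_contra! hlt
  set g := min g₀ (gPrev + r * G.gMax) with hg
  have h1 : g ≤ g₀ := min_le_left _ _
  have h2 : g ≤ gPrev + r * G.gMax := min_le_right _ _
  have h3 := abs_le.1 h.1.ramping
  have h0 := h.1.output
  -- Sell the extra output: the revenue is nonnegative and the generation cost drops strictly.
  -- Strictness is needed because the selling price may be zero.
  have hf : G.SlotFeasible r q gPrev (u.trade g u.eb (u.es + (g - u.g))) :=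
    h.1.trade ⟨by linarith, by linarith⟩ (abs_le.2 ⟨by linarith, by linarith⟩) h.1.bought
      (by linarith [h.1.sold]) (by ring)
  have h4 := h.driftPenalty_le hf
  rw [G.driftPenalty_trade] at h4
  have h5 : G.C g < G.C u.g := hC ⟨h0.1, by linarith⟩ ⟨by linarith, h1⟩ hlt
  have h6 : 0 ≤ q.ps * (g - u.g) := mul_nonneg hq.ps_nonneg (by linarith)
  nlinarith

/-- Any action can be adapted to the ramping constraint at a bounded extra cost. -/
lemma Grid.exists_slotFeasible_driftPenalty_le (G : Grid N) {r r' V : ℝ} (hr : r ∈ Icc (0 : ℝ) 1)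
    (hV : 0 < V) {q : State N} (hq : G.ValidState q) {gPrev gPrev' g₀ : ℝ} (hg₀ : 0 ≤ g₀)
    (hanti : AntitoneOn G.C (Icc 0 g₀)) (hmono : MonotoneOn G.C (Icc g₀ G.gMax))
    (hgPrev : gPrev ∈ Icc g₀ G.gMax) {v : Action N} (hv : G.SlotFeasible r' q gPrev' v)
    (s : Fin N → ℝ) (J : ℝ) :
    ∃ v', G.SlotFeasible r q gPrev v' ∧ G.driftPenalty V s J q v' ≤
      G.driftPenalty V s J q v + V * ((1 - r) * G.gMax * max G.pbMax G.dC_max) := by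
  obtain ⟨hv0, hv1⟩ := hv.output
  obtain ⟨hp0, hp1⟩ := hgPrev
  obtain ⟨hr0, hr1⟩ := hr
  have hrg : 0 ≤ r * G.gMax := mul_nonneg hr0 G.gMax_nonneg
  have hrg' : 0 ≤ (1 - r) * G.gMax := mul_nonneg (by linarith) G.gMax_nonneg
  have hpb := hq.pb_pos
  have hpbM := hq.pb_mem.2
  set M := max G.pbMax G.dC_max with hM
  have hM1 : G.pbMax ≤ M := le_max_left _ _
  have hM2 : G.dC_max ≤ M := le_max_right _ _
  have hM0 : 0 ≤ M := by linarith
  -- Raising the output to `g₀` does not increase the generation cost. The result is then clamped to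
  -- the interval reachable from `gPrev`.
  set g₁ := max v.g g₀ with hg₁
  set g := max (gPrev - r * G.gMax) (min g₁ (gPrev + r * G.gMax)) with hg
  have hg1le : g₁ ≤ G.gMax := max_le hv1 (by linarith)
  have hCg₁ : G.C g₁ ≤ G.C v.g := by
    rcases le_total v.g g₀ with h | h
    · rw [hg₁, max_eq_right h]
      exact hanti ⟨hv0, h⟩ ⟨hg₀, le_rfl⟩ h
    · rw [hg₁, max_eq_left h]
  have hg₁v : v.g ≤ g₁ := le_max_left _ _
  have hg₁0 : g₀ ≤ g₁ := le_max_right _ _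
  have hgg0 : g₀ ≤ g := (le_min hg₁0 (by linarith)).trans (le_max_right _ _)
  have hggM : g ≤ G.gMax := max_le (by linarith) ((min_le_left _ _).trans hg1le)
  have hramp : |g - gPrev| ≤ r * G.gMax := by
    have h1 : gPrev - r * G.gMax ≤ g := le_max_left _ _
    have h2 : g ≤ gPrev + r * G.gMax := max_le (by linarith) (min_le_right _ _)
    exact abs_le.2 ⟨by linarith, by linarith⟩
  rcases le_or_gt g₁ g with hle | hle
  -- Surplus: it is sold at a nonnegative price. Only the rise of `C` from `g₁` to `g` costs
  -- anything, and `g > g₁` forces `g = gPrev - r gMax ≤ (1 - r) gMax`.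
  · refine ⟨v.trade g v.eb (v.es + (g - v.g)), hv.trade ⟨by linarith, hggM⟩ hramp hv.bought
      (by linarith [hv.sold]) (by ring), ?_⟩
    rw [G.driftPenalty_trade]
    have hd : g - g₁ ≤ (1 - r) * G.gMax := by
      rcases max_choice (gPrev - r * G.gMax) (min g₁ (gPrev + r * G.gMax)) with h | h
      · rw [hg, h]; linarith
      · have : g ≤ g₁ := by rw [hg, h]; exact min_le_left _ _
        linarith
    have h1 := G.C_sub_le ⟨by linarith, hg1le⟩ ⟨by linarith, hggM⟩ hle
    have h2 : G.dC_max * (g - g₁) ≤ M * ((1 - r) * G.gMax) :=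
      (mul_le_mul_of_nonneg_right hM2 (by linarith)).trans (mul_le_mul_of_nonneg_left hd hM0)
    have h3 : 0 ≤ q.ps * (g - v.g) := mul_nonneg hq.ps_nonneg (by linarith)
    have h4 : G.C g - G.C v.g + q.pb * (v.eb - v.eb) - q.ps * (v.es + (g - v.g) - v.es)
        ≤ (1 - r) * G.gMax * M := by linarith
    linarith [mul_le_mul_of_nonneg_left h4 hV.le]
  -- Shortage: it is bought, while `C` decreases by monotonicity above `g₀`. Here `g ≥ gPrev + r
  -- gMax ≥ r gMax`, so at most `(1 - r) gMax` is missing.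
  · have hgv : g₁ = v.g := by
      rcases le_total v.g g₀ with h | h
      · have : g₁ = g₀ := max_eq_right h
        linarith
      · exact max_eq_left h
    have hgr : gPrev + r * G.gMax ≤ g := by
      by_contra! hlt
      have : min g₁ (gPrev + r * G.gMax) ≤ g := le_max_right _ _
      rcases min_choice g₁ (gPrev + r * G.gMax) with h | h <;> linarith
    refine ⟨v.trade g (v.eb + (v.g - g)) v.es, hv.trade ⟨by linarith, hggM⟩ hramp
      (by linarith [hv.bought]) hv.sold (by ring), ?_⟩
    rw [G.driftPenalty_trade]
    have h1 : G.C g ≤ G.C v.g := hmono ⟨hgg0, hggM⟩ ⟨by linarith, hv1⟩ (by linarith)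
    have h2 : q.pb * (v.g - g) ≤ M * ((1 - r) * G.gMax) :=
      mul_le_mul (by linarith) (by linarith) (by linarith) hM0
    have h4 : G.C g - G.C v.g + q.pb * (v.eb + (v.g - g) - v.eb) - q.ps * (v.es - v.es)
        ≤ (1 - r) * G.gMax * M := by linarith
    linarith [mul_le_mul_of_nonneg_left h4 hV.le]

/-! ### The Lyapunov function and pathwise bounds. -/

/-- The Lyapunov function of the energy states and the backlog. -/
noncomputable def Grid.lyapunov (G : Grid N) (V : ℝ) (s : Fin N → ℝ) (J : ℝ) : ℝ :=
  1 / 2 * J ^ 2 + 1 / 2 * ∑ i, (s i - G.β V i) ^ 2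

lemma Grid.lyapunov_nonneg (G : Grid N) (V : ℝ) (s : Fin N → ℝ) (J : ℝ) :
    0 ≤ G.lyapunov V s J := by
  unfold Grid.lyapunov
  have : 0 ≤ ∑ i, (s i - G.β V i) ^ 2 := Finset.sum_nonneg fun i _ => sq_nonneg _
  positivity

/-- Expanding the squares leaves the terms linear in `J` and `s - β`; the remaining quadratic terms
are bounded by `B`. When the maximum truncates at `0`, the missing part is compensated by `(J - α) ^
2 ≥ 0`. -/
lemma Grid.lyapunov_drift_le (G : Grid N) (V : ℝ) (s x : Fin N → ℝ) {J y : ℝ} (hJ : 0 ≤ J)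
    (hy : y ∈ Icc (0 : ℝ) 1) (hx : ∀ i, G.xMin i ≤ x i ∧ x i ≤ G.xMax i) :
    G.lyapunov V (fun i => s i + x i) (max (J - G.α) 0 + y) - G.lyapunov V s J
      ≤ G.B + J * (y - G.α) + ∑ i, (s i - G.β V i) * x i := by
  obtain ⟨hy0, hy1⟩ := hy
  obtain ⟨ha0, ha1⟩ := G.α_mem
  have h1 : (max (J - G.α) 0 + y) ^ 2 ≤ J ^ 2 + (1 + G.α ^ 2) + 2 * (J * (y - G.α)) := by
    rcases le_total (J - G.α) 0 with h | h
    · rw [max_eq_right h]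
      nlinarith [sq_nonneg (J - G.α), mul_nonneg hJ hy0]
    · rw [max_eq_left h]
      nlinarith [mul_nonneg ha0 hy0]
  have h2 : ∑ i, (s i + x i - G.β V i) ^ 2 ≤ ∑ i, (s i - G.β V i) ^ 2
      + ∑ i, max (G.xMin i ^ 2) (G.xMax i ^ 2) + 2 * ∑ i, (s i - G.β V i) * x i := by
    rw [Finset.mul_sum, ← Finset.sum_add_distrib, ← Finset.sum_add_distrib]
    refine Finset.sum_le_sum fun i _ => ?_
    have hxi : x i ^ 2 ≤ max (G.xMin i ^ 2) (G.xMax i ^ 2) := by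
      rcases le_total 0 (x i) with h | h
      · exact le_max_of_le_right (by nlinarith [(hx i).2])
      · exact le_max_of_le_left (by nlinarith [(hx i).1])
    linarith [sq_nonneg (s i + x i - G.β V i)]
  simp only [Grid.lyapunov, Grid.B]
  linarith

lemma Grid.backlog_mem (G : Grid N) {q : ℕ → State N} {u : ℕ → Action N}
    (h : ∀ t, unsatisfied (q t) (u t) ∈ Icc (0 : ℝ) 1) (t : ℕ) :
    G.backlog q u t ∈ Icc (0 : ℝ) t := by
  induction t with
  | zero => simp [Grid.backlog]
  | succ t ih =>
    have h1 : max (G.backlog q u t - G.α) 0 ≤ t :=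
      max_le (by linarith [ih.2, G.α_mem.1]) (Nat.cast_nonneg t)
    refine ⟨add_nonneg (le_max_right _ _) (h t).1, ?_⟩
    push_cast
    exact add_le_add h1 (h t).2

/-- A bound growing with `t` suffices, since it serves only for integrability in each fixed slot. -/
lemma Grid.abs_energyState_le (G : Grid N) {s0 : Fin N → ℝ} {u : ℕ → Action N}
    (h : ∀ t i, G.xMin i ≤ (u t).x i ∧ (u t).x i ≤ G.xMax i) (t : ℕ) (i : Fin N) :
    |energyState s0 u t i| ≤ |s0 i| + t * (G.xMax i - G.xMin i) := by
  induction t with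
  | zero => simp [energyState]
  | succ t ih =>
    have hx : |(u t).x i| ≤ G.xMax i - G.xMin i :=
      abs_le.2 ⟨by linarith [(h t i).1, G.xMax_pos i], by linarith [(h t i).2, G.xMin_neg i]⟩
    have := abs_add_le (energyState s0 u t i) ((u t).x i)
    simp only [energyState]
    push_cast
    linarith

lemma energyState_eq_add_sum (s0 : Fin N → ℝ) (u : ℕ → Action N) (t : ℕ) (i : Fin N) :
    energyState s0 u t i = s0 i + ∑ k ∈ Finset.range t, (u k).x i := by
  induction t with
  | zero => simp [energyState]
  | succ t ih => simp only [energyState, Finset.sum_range_succ, ih]; ring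

/-! ### Measurability and boundedness of the cost. -/

/-- A continuous extension of the system cost to all actions. -/
noncomputable def Grid.costExt (G : Grid N) (q : State N) (u : Action N) : ℝ :=
  G.C (max 0 (min u.g G.gMax)) + q.pb * u.eb - q.ps * u.es
    + ∑ i, G.D i (max (G.xMin i) (min (u.x i) (G.xMax i)))

lemma Grid.SlotFeasible.costExt_eq {G : Grid N} {r : ℝ} {q : State N} {gPrev : ℝ} {u : Action N}
    (h : G.SlotFeasible r q gPrev u) : G.costExt q u = G.cost q u := by
  simp only [Grid.costExt, Grid.cost]
  rw [min_eq_left h.output.2, max_eq_right h.output.1]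
  congr 1
  refine Finset.sum_congr rfl fun i _ => ?_
  rw [min_eq_left (h.charging i).2, max_eq_right (h.charging i).1]

lemma Grid.measurable_costExt (G : Grid N) :
    Measurable fun p : State N × Action N => G.costExt p.1 p.2 := by
  have hC : Continuous fun g => G.C (max 0 (min g G.gMax)) :=
    G.C_contDiff.continuousOn.comp_continuous (by fun_prop) fun g =>
      ⟨le_max_left _ _, max_le G.gMax_nonneg (min_le_right _ _)⟩
  have hD : ∀ i, Continuous fun x => G.D i (max (G.xMin i) (min x (G.xMax i))) := fun i =>
    (G.D_contDiff i).continuousOn.comp_continuous (by fun_prop) fun g =>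
      ⟨le_max_left _ _, max_le (by linarith [G.xMin_neg i, G.xMax_pos i]) (min_le_right _ _)⟩
  have hC' := hC.measurable
  have hD' := fun i => (hD i).measurable
  unfold Grid.costExt Action.g Action.eb Action.es Action.x State.pb State.ps
  have h1 := hC'.comp (g := fun g => G.C (max 0 (min g G.gMax)))
    (f := fun p : State N × Action N => p.2.2.2.2.1) (by fun_prop)
  have h2 := fun i => (hD' i).comp (g := fun x => G.D i (max (G.xMin i) (min x (G.xMax i))))
    (f := fun p : State N × Action N => p.2.2.1 i) (by fun_prop)
  simp only [Function.comp_def] at h1 h2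
  fun_prop

lemma measurable_unsatisfied :
    Measurable fun p : State N × Action N => unsatisfied p.1 p.2 := by
  unfold unsatisfied State.lb State.lf Action.lm
  fun_prop

lemma measurable_x (i : Fin N) : Measurable fun u : Action N => u.x i := by
  unfold Action.x
  fun_prop

/-- The actions that satisfy all constraints of a slot but the ramping constraint. -/
lemma Grid.measurableSet_slotFeasible (G : Grid N) :
    MeasurableSet {p : State N × Action N | G.SlotFeasible 0 p.1 p.2.g p.2} := by
  have : {p : State N × Action N | G.SlotFeasible 0 p.1 p.2.g p.2} =
      {p : State N × Action N | (p.1.lb ≤ p.2.lm ∧ p.2.lm ≤ p.1.lb + p.1.lf) ∧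
        (∀ i, G.xMin i ≤ p.2.x i ∧ p.2.x i ≤ G.xMax i) ∧
        (∀ i, p.2.b i = p.1.a i - p.2.x i ∧ 0 ≤ p.2.b i) ∧
        (0 ≤ p.2.g ∧ p.2.g ≤ G.gMax) ∧ 0 ≤ p.2.eb ∧ 0 ≤ p.2.es ∧
        p.2.g + p.2.eb + ∑ i, p.2.b i = p.2.es + p.2.lm} := by
    ext p
    exact ⟨fun h => ⟨h.1, h.2, h.3, h.4, h.6, h.7, h.8⟩,
      fun ⟨h1, h2, h3, h4, h6, h7, h8⟩ => ⟨h1, h2, h3, h4, by simp, h6, h7, h8⟩⟩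
  rw [this]
  unfold Action.lm Action.x Action.b Action.g Action.eb Action.es State.lb State.lf State.a
  have le {f g : State N × Action N → ℝ} (hf : Measurable f) (hg : Measurable g) :
      MeasurableSet {p | f p ≤ g p} := measurableSet_le hf hg
  have eq {f g : State N × Action N → ℝ} (hf : Measurable f) (hg : Measurable g) :
      MeasurableSet {p | f p = g p} := measurableSet_eq_fun hf hg
  have all {P : Fin N → State N × Action N → Prop} (h : ∀ i, MeasurableSet {p | P i p}) :
      MeasurableSet {p | ∀ i, P i p} := by
    rw [show {p | ∀ i, P i p} = ⋂ i, {p | P i p} by ext; simp]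
    exact .iInter h
  refine ((le ?_ ?_).inter (le ?_ ?_)).inter
    ((all fun i => (le ?_ ?_).inter (le ?_ ?_)).inter
      ((all fun i => (eq ?_ ?_).inter (le ?_ ?_)).inter (((le ?_ ?_).inter
        (le ?_ ?_)).inter ((le ?_ ?_).inter ((le ?_ ?_).inter (eq ?_ ?_)))))) <;> fun_prop

/-- The cost of optimal actions is uniformly bounded. -/
lemma Grid.exists_abs_cost_le (G : Grid N) : ∃ M, ∀ (r V : ℝ) (s : Fin N → ℝ) (J : ℝ) (q : State N)
    (gPrev : ℝ) (u : Action N), 0 < V → G.ValidState q → G.SolvesSlot r V s J q gPrev u →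
      |G.cost q u| ≤ M := by
  obtain ⟨MC, hMC⟩ := isCompact_Icc.exists_bound_of_continuousOn G.C_contDiff.continuousOn
  choose MD hMD using fun i =>
    isCompact_Icc.exists_bound_of_continuousOn (G.D_contDiff i).continuousOn
  -- `Z` bounds the energy traded: since an optimal action trades in one direction only, the balance
  -- equation determines the amount.
  set Z := G.gMax + ∑ i, (G.aMax i - G.xMin i) + |G.lbMin| + |G.lbMax| + |G.lfMax| with hZ
  refine ⟨MC + G.pbMax * Z + ∑ i, MD i, fun r V s J q gPrev u hV hq hu => ?_⟩
  have h := hu.1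
  have hpb := hq.pb_pos
  have hps := hq.ps_nonneg
  have hlt := hq.ps_lt_pb
  have hb : ∑ i, u.b i ≤ ∑ i, (G.aMax i - G.xMin i) := Finset.sum_le_sum fun i _ => by
    rw [(h.contribution i).1]
    linarith [(hq.a_mem i).2, (h.charging i).1]
  have hb0 : 0 ≤ ∑ i, u.b i := Finset.sum_nonneg fun i _ => (h.contribution i).2
  have hb1 := hb0.trans hb
  have hC : |G.C u.g| ≤ MC := hMC _ ⟨h.output.1, h.output.2⟩
  have hD : |∑ i, G.D i (u.x i)| ≤ ∑ i, MD i := (Finset.abs_sum_le_sum_abs _ _).trans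
    (Finset.sum_le_sum fun i _ => hMD i _ ⟨(h.charging i).1, (h.charging i).2⟩)
  have hE : |q.pb * u.eb - q.ps * u.es| ≤ G.pbMax * Z := by
    have hbal := h.balance
    have hl := h.loads
    have := hq.lb_mem
    have := hq.lf_mem
    have := h.output
    have := G.gMax_nonneg
    have := h.bought
    have := h.sold
    have := neg_abs_le G.lbMin
    have := le_abs_self G.lbMax
    have := le_abs_self G.lfMax
    have := abs_nonneg G.lbMin
    have := abs_nonneg G.lbMax
    have hq1 := hq.lb_mem.1
    have hq2 := hq.lb_mem.2
    have hq3 := hq.lf_mem.2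
    have hpM := hq.pb_mem.2
    rcases hu.eb_eq_zero_or hV hq with h0 | h0
    · have hes : u.es ≤ Z := by linarith
      rw [h0, mul_zero, zero_sub, abs_neg, abs_of_nonneg (mul_nonneg hps h.sold)]
      exact mul_le_mul (by linarith) hes h.sold (by linarith)
    · have heb : u.eb ≤ Z := by linarith
      rw [h0, mul_zero, sub_zero, abs_of_nonneg (mul_nonneg hpb.le h.bought)]
      exact mul_le_mul (by linarith) heb h.bought (by linarith)
  have e : G.cost q u = G.C u.g + (q.pb * u.eb - q.ps * u.es) + ∑ i, G.D i (u.x i) := by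
    simp only [Grid.cost]; ring
  rw [e]
  exact (abs_add_three _ _ _).trans (by linarith)

/-! ### Resampling an action through its conditional distribution. -/

variable {Ω : Type*} [mΩ : MeasurableSpace Ω]

section CondDistrib

variable {E F : Type*} [MeasurableSpace E] [MeasurableSpace F] [StandardBorelSpace F] [Nonempty F]
  {μ : Measure Ω} [IsProbabilityMeasure μ] {X X' : Ω → E} {Y : Ω → F} {f : E × F → ℝ}

/-- `X'` has the law of `X`, so drawing `y` from the conditional law of `Y` given `X`, evaluated at
`X'`, reproduces the joint law of `(X, Y)`. The next lemmas exploit the same fact for integrals. -/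
lemma ae_ae_condDistrib_of_map_eq (hX : Measurable X) (hX' : Measurable X') (hY : Measurable Y)
    (hmap : μ.map X' = μ.map X) {p : E × F → Prop} (hp : MeasurableSet {z | p z})
    (h : ∀ᵐ ω ∂μ, p (X ω, Y ω)) :
    ∀ᵐ ω ∂μ, ∀ᵐ y ∂(condDistrib Y X μ (X' ω)), p (X' ω, y) := by
  have h1 : ∀ᵐ z ∂(μ.map fun ω => (X ω, Y ω)), p z :=
    (ae_map_iff (hX.prodMk hY).aemeasurable hp).2 h
  rw [← compProd_map_condDistrib hY.aemeasurable] at h1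
  have h2 := Measure.ae_ae_of_ae_compProd h1
  rw [← hmap] at h2
  exact ae_of_ae_map hX'.aemeasurable h2

omit [StandardBorelSpace F] [Nonempty F] [IsProbabilityMeasure μ] in
lemma integrable_map_prodMk (hX : Measurable X) (hY : Measurable Y) (hf : Measurable f)
    (hint : Integrable (fun ω => f (X ω, Y ω)) μ) :
    Integrable f (μ.map fun ω => (X ω, Y ω)) :=
  (integrable_map_measure hf.aestronglyMeasurable (hX.prodMk hY).aemeasurable).2 hint

lemma ae_integrable_condDistrib_of_map_eq (hX : Measurable X) (hX' : Measurable X')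
    (hY : Measurable Y) (hmap : μ.map X' = μ.map X) (hf : Measurable f)
    (hint : Integrable (fun ω => f (X ω, Y ω)) μ) :
    ∀ᵐ ω ∂μ, Integrable (fun y => f (X' ω, y)) (condDistrib Y X μ (X' ω)) := by
  have h := (integrable_map_prodMk hX hY hf hint).condDistrib_ae_map hY.aemeasurable
  rw [← hmap] at h
  exact ae_of_ae_map hX'.aemeasurable h

lemma integrable_integral_condDistrib_of_map_eq (hX : Measurable X) (hX' : Measurable X')
    (hY : Measurable Y) (hmap : μ.map X' = μ.map X) (hf : Measurable f)
    (hint : Integrable (fun ω => f (X ω, Y ω)) μ) :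
    Integrable (fun ω => ∫ y, f (X' ω, y) ∂(condDistrib Y X μ (X' ω))) μ := by
  have h := (integrable_map_prodMk hX hY hf hint).integral_condDistrib_map hY.aemeasurable
  rw [← hmap] at h
  exact h.comp_aemeasurable hX'.aemeasurable

lemma integral_integral_condDistrib_of_map_eq (hX : Measurable X) (hX' : Measurable X')
    (hY : Measurable Y) (hmap : μ.map X' = μ.map X) (hf : Measurable f)
    (hint : Integrable (fun ω => f (X ω, Y ω)) μ) :
    ∫ ω, ∫ y, f (X' ω, y) ∂(condDistrib Y X μ (X' ω)) ∂μ = ∫ ω, f (X ω, Y ω) ∂μ := by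
  have h := integrable_map_prodMk hX hY hf hint
  have h1 := h.integral_condDistrib_map hY.aemeasurable
  rw [← hmap] at h1
  rw [← integral_map hX'.aemeasurable h1.aestronglyMeasurable, hmap]
  rw [← compProd_map_condDistrib hY.aemeasurable] at h
  rw [← Measure.integral_compProd h, compProd_map_condDistrib hY.aemeasurable,
    integral_map (hX.prodMk hY).aemeasurable hf.aestronglyMeasurable]

/-- The conditional mean is a measurable function of `X'` alone. -/
lemma indepFun_integral_condDistrib {m : MeasurableSpace Ω} {Z : Ω → ℝ} (hZ : Measurable[m] Z)
    (hind : Indep (MeasurableSpace.comap X' inferInstance) m μ) (hf : Measurable f) :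
    IndepFun Z (fun ω => ∫ y, f (X' ω, y) ∂(condDistrib Y X μ (X' ω))) μ := by
  have hF : Measurable fun x => ∫ y, f (x, y) ∂(condDistrib Y X μ x) :=
    (hf.stronglyMeasurable.integral_condDistrib).measurable
  rw [IndepFun_iff_Indep]
  refine (indep_of_indep_of_le_left (indep_of_indep_of_le_right hind hZ.comap_le) ?_).symm
  change MeasurableSpace.comap ((fun x => ∫ y, f (x, y) ∂(condDistrib Y X μ x)) ∘ X') _ ≤ _
  rw [← MeasurableSpace.comap_comp]
  exact MeasurableSpace.comap_mono hF.comap_le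

end CondDistrib

lemma integrable_add_sum_add {α : Type*} [MeasurableSpace α] {ν : Measure α}
    [IsProbabilityMeasure ν] {c y : α → ℝ} {x : Fin N → α → ℝ} (hc : Integrable c ν)
    (hx : ∀ i, Integrable (x i) ν) (hy : Integrable y ν) (δ : ℝ) :
    Integrable (fun a => c a + ∑ i, x i a + y a + δ) ν :=
  ((hc.add (integrable_finsetSum _ fun i _ => hx i)).add hy).add (integrable_const _)

lemma integral_add_sum_add {α : Type*} [MeasurableSpace α] {ν : Measure α}
    [IsProbabilityMeasure ν] {c y : α → ℝ} {x : Fin N → α → ℝ} (hc : Integrable c ν)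
    (hx : ∀ i, Integrable (x i) ν) (hy : Integrable y ν) (δ : ℝ) :
    ∫ a, (c a + ∑ i, x i a + y a + δ) ∂ν
      = ∫ a, c a ∂ν + ∑ i, ∫ a, x i a ∂ν + ∫ a, y a ∂ν + δ := by
  have hs : Integrable (fun a => ∑ i, x i a) ν := integrable_finsetSum _ fun i _ => hx i
  have h1 : Integrable (fun a => c a + ∑ i, x i a) ν := hc.add hs
  have h2 : Integrable (fun a => c a + ∑ i, x i a + y a) ν := h1.add hy
  rw [integral_add h2 (integrable_const _), integral_add h1 hy, integral_add hc hs,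
    integral_finsetSum _ fun i _ => hx i]
  simp

instance : StandardBorelSpace (Action N) := by
  have h2 : StandardBorelSpace (ℝ × ℝ) := inferInstance
  have h3 : StandardBorelSpace (ℝ × ℝ × ℝ) := inferInstance
  have h4 : StandardBorelSpace (ℝ × ℝ × ℝ × ℝ) := inferInstance
  have h5 : StandardBorelSpace ((Fin N → ℝ) × ℝ × ℝ × ℝ × ℝ) := inferInstance
  exact (inferInstance : StandardBorelSpace ((Fin N → ℝ) × (Fin N → ℝ) × ℝ × ℝ × ℝ × ℝ))

/-- If the present system state is independent of the energy states and of the backlog, then an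
optimal action does, on average, at least as well as any action `v` taken in another slot whose
system state has the same distribution. -/
lemma Grid.integral_driftPenalty_le {Ω : Type*} {m : MeasurableSpace Ω}
    [mΩ : MeasurableSpace Ω] (G : Grid N) {μ : Measure Ω} [IsProbabilityMeasure μ]
    {r r' V : ℝ} (hr : r ∈ Icc (0 : ℝ) 1) (hV : 0 < V) {g₀ : ℝ} (hg₀ : 0 ≤ g₀)
    (hanti : AntitoneOn G.C (Icc 0 g₀)) (hmono : MonotoneOn G.C (Icc g₀ G.gMax))
    {q q' : Ω → State N} (hq : Measurable q)
    (hq' : Measurable q') (hmap : μ.map q = μ.map q')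
    (hind : Indep (MeasurableSpace.comap q inferInstance) m μ)
    (hvalid : ∀ᵐ ω ∂μ, G.ValidState (q ω)) (hvalid' : ∀ᵐ ω ∂μ, G.ValidState (q' ω))
    {S : Ω → Fin N → ℝ} {J gPrev g' : Ω → ℝ}
    (hS : ∀ i, Measurable[m] fun ω => S ω i) (hSi : ∀ i, Integrable (fun ω => S ω i) μ)
    (hJ : Measurable[m] J) (hJi : Integrable J μ) (hgPrev : ∀ᵐ ω ∂μ, gPrev ω ∈ Icc g₀ G.gMax)
    {u v : Ω → Action N} (hu : ∀ᵐ ω ∂μ, G.SolvesSlot r V (S ω) (J ω) (q ω) (gPrev ω) (u ω))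
    (hui : Integrable (fun ω => G.driftPenalty V (S ω) (J ω) (q ω) (u ω)) μ)
    (hv : Measurable v) (hvf : ∀ᵐ ω ∂μ, G.SlotFeasible r' (q' ω) (g' ω) (v ω))
    (hvi : Integrable (fun ω => G.cost (q' ω) (v ω)) μ) :
    ∫ ω, G.driftPenalty V (S ω) (J ω) (q ω) (u ω) ∂μ ≤
      V * ∫ ω, G.cost (q' ω) (v ω) ∂μ
      + ∑ i, (∫ ω, S ω i ∂μ - G.β V i) * ∫ ω, (v ω).x i ∂μ
      + (∫ ω, J ω ∂μ) * ∫ ω, unsatisfied (q' ω) (v ω) ∂μ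
      + V * ((1 - r) * G.gMax * max G.pbMax G.dC_max) := by
  set δ := V * ((1 - r) * G.gMax * max G.pbMax G.dC_max) with hδ
  set κ := condDistrib v q' μ with hκ
  -- Taking the action's own output as previous output, with coefficient `0`, makes the ramping
  -- constraint void; the remaining constraints involve only the state and the action, so they
  -- survive resampling.
  have hfeas := ae_ae_condDistrib_of_map_eq hq' hq hv hmap (G.measurableSet_slotFeasible)
    (hvf.mono fun ω h => (h.trade (r' := 0) (gPrev' := (v ω).g) h.output (by simp) h.bought h.sold
      rfl : G.SlotFeasible 0 (q' ω) (v ω).g ((v ω).trade (v ω).g (v ω).eb (v ω).es)))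
  have hci : Integrable (fun ω => G.costExt (q' ω) (v ω)) μ :=
    hvi.congr (hvf.mono fun ω h => h.costExt_eq.symm)
  have hc_eq : ∫ ω, G.cost (q' ω) (v ω) ∂μ = ∫ ω, G.costExt (q' ω) (v ω) ∂μ :=
    integral_congr_ae (hvf.mono fun ω h => h.costExt_eq.symm)
  have hxi : ∀ i, Integrable (fun ω => (v ω).x i) μ := fun i =>
    Integrable.of_mem_Icc (G.xMin i) (G.xMax i) ((measurable_x i).comp hv).aemeasurable
      (hvf.mono fun ω h => h.charging i)
  have hyi : Integrable (fun ω => unsatisfied (q' ω) (v ω)) μ :=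
    Integrable.of_mem_Icc 0 1 (measurable_unsatisfied.comp (hq'.prodMk hv)).aemeasurable
      (by filter_upwards [hvf, hvalid'] with ω h h' using h.unsatisfied_mem h')
  have mc := G.measurable_costExt
  have mx : ∀ i, Measurable fun p : State N × Action N => p.2.x i := fun i =>
    (measurable_x i).comp measurable_snd
  have my := measurable_unsatisfied (N := N)
  have ac := ae_integrable_condDistrib_of_map_eq hq' hq hv hmap mc hci
  have ax := fun i => ae_integrable_condDistrib_of_map_eq hq' hq hv hmap (mx i) (hxi i)
  have ay := ae_integrable_condDistrib_of_map_eq hq' hq hv hmap my hyi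
  have ic := integrable_integral_condDistrib_of_map_eq hq' hq hv hmap mc hci
  have ix := fun i => integrable_integral_condDistrib_of_map_eq hq' hq hv hmap (mx i) (hxi i)
  have iy := integrable_integral_condDistrib_of_map_eq hq' hq hv hmap my hyi
  have ec := integral_integral_condDistrib_of_map_eq hq' hq hv hmap mc hci
  have ex := fun i => integral_integral_condDistrib_of_map_eq hq' hq hv hmap (mx i) (hxi i)
  have ey := integral_integral_condDistrib_of_map_eq hq' hq hv hmap my hyi
  have nx : ∀ i, IndepFun (fun ω => S ω i - G.β V i) (fun ω => ∫ w, w.x i ∂(κ (q ω))) μ :=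
    fun i => indepFun_integral_condDistrib ((hS i).sub_const _) hind (mx i)
  have ny : IndepFun J (fun ω => ∫ w, unsatisfied (q ω) w ∂(κ (q ω))) μ :=
    indepFun_integral_condDistrib hJ hind my
  have hSi' : ∀ i, Integrable (fun ω => S ω i - G.β V i) μ := fun i =>
    (hSi i).sub (integrable_const _)
  have jx : ∀ i, Integrable (fun ω => (S ω i - G.β V i) * ∫ w, w.x i ∂(κ (q ω))) μ := fun i =>
    (nx i).integrable_mul (hSi' i) (ix i)
  have jy : Integrable (fun ω => J ω * ∫ w, unsatisfied (q ω) w ∂(κ (q ω))) μ :=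
    ny.integrable_mul hJi iy
  have key : ∀ᵐ ω ∂μ, G.driftPenalty V (S ω) (J ω) (q ω) (u ω) ≤
      V * ∫ w, G.costExt (q ω) w ∂(κ (q ω))
        + ∑ i, (S ω i - G.β V i) * ∫ w, w.x i ∂(κ (q ω))
        + J ω * ∫ w, unsatisfied (q ω) w ∂(κ (q ω)) + δ := by
    filter_upwards [hu, hvalid, hgPrev, hfeas, ac, ae_all_iff.2 ax, ay] with ω h1 h2 h3 h4 h5 h6 h7
    have i1 := h5.const_mul V
    have i2 := fun i => (h6 i).const_mul (S ω i - G.β V i)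
    have i3 := h7.const_mul (J ω)
    have e := integral_add_sum_add i1 i2 i3 δ
    simp only [integral_const_mul] at e
    rw [hκ, ← e]
    have : G.driftPenalty V (S ω) (J ω) (q ω) (u ω)
        = ∫ _, G.driftPenalty V (S ω) (J ω) (q ω) (u ω) ∂(condDistrib v q' μ (q ω)) := by simp
    rw [this]
    refine integral_mono_ae (integrable_const _) (integrable_add_sum_add i1 i2 i3 δ) ?_
    filter_upwards [h4] with w hw
    -- The adapted action is used pointwise in `w`, so no measurable selection is needed. The extra
    -- cost is uniform, so any dependence of `gPrev` on the energy states and backlog is harmless.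
    obtain ⟨w', hw', hle⟩ := G.exists_slotFeasible_driftPenalty_le hr hV h2 hg₀ hanti hmono h3 hw
      (S ω) (J ω)
    refine (h1.driftPenalty_le hw').trans (hle.trans (le_of_eq ?_))
    rw [hw.costExt_eq]
    rfl
  refine (integral_mono_ae hui (integrable_add_sum_add (ic.const_mul V) jx jy δ) key).trans
    (le_of_eq ?_)
  rw [integral_add_sum_add (ic.const_mul V) jx jy δ, integral_const_mul, ec, hc_eq,
    ny.integral_fun_mul_eq_mul_integral hJi.aestronglyMeasurable iy.aestronglyMeasurable, ey]
  congr 3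
  refine Finset.sum_congr rfl fun i _ => ?_
  rw [(nx i).integral_fun_mul_eq_mul_integral (hSi' i).aestronglyMeasurable
    (ix i).aestronglyMeasurable, ex i, integral_sub (hSi i) (integrable_const _)]
  simp

/-! ### Long-run averages. -/

/-- Divide by `K`, let `K → ∞`, then `ε → 0`; `d` depends on neither. -/
lemma le_of_forall_eventually_mul_le {l m a d : ℝ} (ha : 0 ≤ a)
    (h : ∀ ε > 0, ∀ᶠ K : ℕ in atTop, K * l ≤ K * (m + a * ε) + d) : l ≤ m := by
  refine le_of_forall_pos_le_add fun η hη => ?_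
  have hε : 0 < η / (2 * (a + 1)) := by positivity
  obtain ⟨K, hK, hK0, hKd⟩ := ((h _ hε).and ((eventually_gt_atTop 0).and
    ((tendsto_natCast_atTop_atTop (R := ℝ)).eventually_ge_atTop (2 * d / η)))).exists
  have hK0' : (0 : ℝ) < K := Nat.cast_pos.2 hK0
  have h1 : a * (η / (2 * (a + 1))) ≤ η / 2 := by
    rw [mul_div_assoc', div_le_div_iff₀ (by positivity) (by norm_num)]
    nlinarith
  rw [div_le_iff₀ hη] at hKd
  have h2 : K * (a * (η / (2 * (a + 1)))) ≤ K * (η / 2) := mul_le_mul_of_nonneg_left h1 hK0'.le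
  have h3 : K * l ≤ K * (m + η) := by linarith
  exact le_of_mul_le_mul_left h3 hK0'

lemma eventually_sum_le_of_longRunAverage_lt {f : ℕ → ℝ} {c : ℝ}
    (h : longRunAverage f < (c : EReal)) :
    ∀ᶠ K : ℕ in atTop, ∑ t ∈ Finset.range K, f t ≤ K * c := by
  filter_upwards [eventually_lt_of_limsup_lt h, eventually_gt_atTop 0] with K hK hK0
  have hK0' : (0 : ℝ) < K := Nat.cast_pos.2 hK0
  have := (EReal.coe_lt_coe_iff.1 hK).le
  rwa [one_div, inv_mul_le_iff₀ hK0'] at this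

lemma longRunAverage_le_of_eventually_sum_le {f : ℕ → ℝ} {c A : ℝ}
    (h : ∀ᶠ T : ℕ in atTop, ∑ t ∈ Finset.range T, f t ≤ T * c + A) :
    longRunAverage f ≤ (c : EReal) := by
  have hlim : Tendsto (fun T : ℕ => ((c + A / (T : ℝ) : ℝ) : EReal)) atTop (nhds (c : EReal)) := by
    refine (continuous_coe_real_ereal.tendsto _).comp ?_
    simpa using (tendsto_const_div_atTop_nhds_zero_nat A).const_add c
  rw [← hlim.limsup_eq]
  refine limsup_le_limsup ?_
  filter_upwards [h, eventually_gt_atTop 0] with T hT hT0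
  have hT0' : (0 : ℝ) < T := Nat.cast_pos.2 hT0
  rw [EReal.coe_le_coe_iff, one_div, inv_mul_le_iff₀ hT0']
  have : T * (c + A / T) = T * c + A := by field_simp
  linarith

/-! ### Measurability, integrability and expected drift along a run. -/

section Measurability

variable {𝓗 : Filtration ℕ mΩ} {q : ℕ → Ω → State N} {s0 : Ω → Fin N → ℝ} {u : ℕ → Ω → Action N}

lemma measurable_energyState (hs0 : Measurable[𝓗 0] s0) (hu : ∀ t, Measurable[𝓗 (t + 1)] (u t))
    (t : ℕ) (i : Fin N) :
    Measurable[𝓗 t] fun ω => energyState (s0 ω) (fun k => u k ω) t i := by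
  induction t with
  | zero => exact (measurable_pi_apply i).comp hs0
  | succ t ih => exact (ih.mono (𝓗.mono t.le_succ) le_rfl).add ((measurable_x i).comp (hu t))

lemma Grid.measurable_backlog (G : Grid N) (hq : ∀ t, Measurable[𝓗 (t + 1)] (q t))
    (hu : ∀ t, Measurable[𝓗 (t + 1)] (u t)) (t : ℕ) :
    Measurable[𝓗 t] fun ω => G.backlog (fun k => q k ω) (fun k => u k ω) t := by
  induction t with
  | zero => exact measurable_const
  | succ t ih =>
    refine Measurable.add (((ih.mono (𝓗.mono t.le_succ) le_rfl).sub_const _).max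
      measurable_const) ?_
    exact measurable_unsatisfied.comp ((hq t).prodMk (hu t))

end Measurability

section Run

variable {G : Grid N} {μ : Measure Ω} {𝓗 : Filtration ℕ mΩ}
  {q : ℕ → Ω → State N} {s0 : Ω → Fin N → ℝ} {gInit : Ω → ℝ} {r V : ℝ} {u : ℕ → Ω → Action N}

lemma Grid.IIDEnvironment.measurable_state (henv : G.IIDEnvironment μ 𝓗 q s0 gInit) (t : ℕ) :
    Measurable (q t) :=
  (henv.state_measurable t).mono (𝓗.le _) le_rfl

lemma Grid.IsAlgorithmRun.measurable (hu : G.IsAlgorithmRun μ 𝓗 q s0 gInit r V u) (t : ℕ) :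
    Measurable (u t) :=
  (hu.causal t).mono (𝓗.le _) le_rfl

lemma Grid.IsAlgorithmRun.slotFeasible (hu : G.IsAlgorithmRun μ 𝓗 q s0 gInit r V u) :
    ∀ᵐ ω ∂μ, ∀ t, G.SlotFeasible r (q t ω) (prevOutput (gInit ω) (fun k => u k ω) t) (u t ω) :=
  ae_all_iff.2 fun t => (hu.solves t).mono fun _ h => h.1

lemma Grid.IsAlgorithmRun.backlog_mem (henv : G.IIDEnvironment μ 𝓗 q s0 gInit)
    (hu : G.IsAlgorithmRun μ 𝓗 q s0 gInit r V u) :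
    ∀ᵐ ω ∂μ, ∀ t : ℕ, G.backlog (fun k => q k ω) (fun k => u k ω) t ∈ Icc (0 : ℝ) t := by
  filter_upwards [hu.slotFeasible, ae_all_iff.2 henv.state_valid] with ω h h'
  exact G.backlog_mem fun t => (h t).unsatisfied_mem (h' t)

lemma Grid.IsAlgorithmRun.memLp_energyState (henv : G.IIDEnvironment μ 𝓗 q s0 gInit)
    (hu : G.IsAlgorithmRun μ 𝓗 q s0 gInit r V u) (t : ℕ) (i : Fin N) :
    MemLp (fun ω => energyState (s0 ω) (fun k => u k ω) t i) ⊤ μ := by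
  refine memLp_top_of_bound ((measurable_energyState henv.init_energy_measurable hu.causal t
    i).mono (𝓗.le t) le_rfl).aestronglyMeasurable
    (|G.sMin i| + |G.sMax i| + t * (G.xMax i - G.xMin i)) ?_
  filter_upwards [hu.slotFeasible, henv.init_energy_mem] with ω h h0
  refine (G.abs_energyState_le (fun t i => (h t).charging i) t i).trans ?_
  have : |s0 ω i| ≤ |G.sMin i| + |G.sMax i| := abs_le.2
    ⟨by linarith [(h0 i).1, neg_abs_le (G.sMin i), abs_nonneg (G.sMax i)],
      by linarith [(h0 i).2, le_abs_self (G.sMax i), abs_nonneg (G.sMin i)]⟩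
  linarith

lemma Grid.IsAlgorithmRun.memLp_backlog (henv : G.IIDEnvironment μ 𝓗 q s0 gInit)
    (hu : G.IsAlgorithmRun μ 𝓗 q s0 gInit r V u) (t : ℕ) :
    MemLp (fun ω => G.backlog (fun k => q k ω) (fun k => u k ω) t) ⊤ μ := by
  refine memLp_top_of_bound ((G.measurable_backlog henv.state_measurable hu.causal t).mono
    (𝓗.le t) le_rfl).aestronglyMeasurable t ?_
  filter_upwards [hu.backlog_mem henv] with ω h
  rw [Real.norm_eq_abs, abs_of_nonneg (h t).1]
  exact (h t).2

variable [IsProbabilityMeasure μ]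

lemma Grid.IsAlgorithmRun.integrable_lyapunov (henv : G.IIDEnvironment μ 𝓗 q s0 gInit)
    (hu : G.IsAlgorithmRun μ 𝓗 q s0 gInit r V u) (t : ℕ) :
    Integrable (fun ω => G.lyapunov V (energyState (s0 ω) (fun k => u k ω) t)
      (G.backlog (fun k => q k ω) (fun k => u k ω) t)) μ := by
  refine (((hu.memLp_backlog henv t).mono_exponent le_top).integrable_sq.const_mul (1 / 2)).add
    ((integrable_finsetSum _ fun i _ => ?_).const_mul (1 / 2))
  exact MemLp.integrable_sq (((hu.memLp_energyState henv t i).mono_exponent le_top).sub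
    (memLp_const _))

lemma Grid.IsAlgorithmRun.integrable_cost (henv : G.IIDEnvironment μ 𝓗 q s0 gInit) (hV : 0 < V)
    (hu : G.IsAlgorithmRun μ 𝓗 q s0 gInit r V u) (t : ℕ) :
    Integrable (fun ω => G.cost (q t ω) (u t ω)) μ := by
  obtain ⟨M, hM⟩ := G.exists_abs_cost_le
  have hmeas : Measurable fun ω => G.costExt (q t ω) (u t ω) :=
    G.measurable_costExt.comp ((henv.measurable_state t).prodMk (hu.measurable t))
  refine Integrable.of_bound (hmeas.aestronglyMeasurable.congr
    ((hu.solves t).mono fun ω h => h.1.costExt_eq)) M ?_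
  filter_upwards [hu.solves t, henv.state_valid t] with ω h h'
  exact hM _ _ _ _ _ _ _ hV h' h

lemma Grid.IsAlgorithmRun.integrable_driftPenalty (henv : G.IIDEnvironment μ 𝓗 q s0 gInit)
    (hV : 0 < V) (hu : G.IsAlgorithmRun μ 𝓗 q s0 gInit r V u) (t : ℕ) :
    Integrable (fun ω => G.driftPenalty V (energyState (s0 ω) (fun k => u k ω) t)
      (G.backlog (fun k => q k ω) (fun k => u k ω) t) (q t ω) (u t ω)) μ := by
  refine (((hu.integrable_cost henv hV t).const_mul V).add
    (integrable_finsetSum _ fun i _ => ?_)).add ?_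
  · refine Integrable.mul_bdd (c := max |G.xMin i| |G.xMax i|) ?_
      ((measurable_x i).comp (hu.measurable t)).aestronglyMeasurable ?_
    · exact (((hu.memLp_energyState henv t i).mono_exponent (p := 1) le_top).integrable
        le_rfl).sub (integrable_const _)
    · filter_upwards [hu.slotFeasible] with ω h
      exact abs_le_max_abs_abs ((h t).charging i).1 ((h t).charging i).2
  · refine Integrable.mul_bdd (c := 1)
      (((hu.memLp_backlog henv t).mono_exponent (p := 1) le_top).integrable le_rfl)
      (measurable_unsatisfied.comp
        ((henv.measurable_state t).prodMk (hu.measurable t))).aestronglyMeasurable ?_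
    filter_upwards [hu.slotFeasible, henv.state_valid t] with ω h h'
    have := (h t).unsatisfied_mem h'
    exact abs_le.2 ⟨by linarith [this.1], this.2⟩

/-- One-slot bound on the expected Lyapunov drift plus penalty. -/
lemma Grid.IsAlgorithmRun.integral_lyapunov_drift_le (henv : G.IIDEnvironment μ 𝓗 q s0 gInit)
    (hV : 0 < V) (hu : G.IsAlgorithmRun μ 𝓗 q s0 gInit r V u) (t : ℕ) :
    ∫ ω, G.lyapunov V (energyState (s0 ω) (fun k => u k ω) (t + 1))
        (G.backlog (fun k => q k ω) (fun k => u k ω) (t + 1)) ∂μ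
      - ∫ ω, G.lyapunov V (energyState (s0 ω) (fun k => u k ω) t)
        (G.backlog (fun k => q k ω) (fun k => u k ω) t) ∂μ
      + V * ∫ ω, G.cost (q t ω) (u t ω) ∂μ
    ≤ G.B - G.α * ∫ ω, G.backlog (fun k => q k ω) (fun k => u k ω) t ∂μ
      + ∫ ω, G.driftPenalty V (energyState (s0 ω) (fun k => u k ω) t)
        (G.backlog (fun k => q k ω) (fun k => u k ω) t) (q t ω) (u t ω) ∂μ := by
  have i1 := hu.integrable_lyapunov henv (t + 1)
  have i2 := hu.integrable_lyapunov henv t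
  have i3 := (hu.integrable_cost henv hV t).const_mul V
  have i4 := (((hu.memLp_backlog henv t).mono_exponent (p := 1) le_top).integrable
    le_rfl).const_mul G.α
  have i5 := hu.integrable_driftPenalty henv hV t
  have hle := integral_mono_ae ((i1.sub i2).add i3) (((integrable_const G.B).sub i4).add i5) (by
    filter_upwards [hu.slotFeasible, henv.state_valid t, hu.backlog_mem henv] with ω h1 h2 h3
    have := G.lyapunov_drift_le V (energyState (s0 ω) (fun k => u k ω) t) (u t ω).x (h3 t).1
      ((h1 t).unsatisfied_mem h2) (h1 t).charging
    simp only [Pi.add_apply, Pi.sub_apply, energyState, Grid.backlog, Grid.driftPenalty]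
    linarith)
  rw [integral_add' (i1.sub i2) i3, integral_sub' i1 i2,
    integral_add' ((integrable_const G.B).sub i4) i5, integral_sub' (integrable_const G.B) i4,
    integral_const_mul, integral_const_mul] at hle
  simpa using hle

end Run

/-! ### Comparison with a feasible process. -/

section Comparison

variable {G : Grid N} {μ : Measure Ω} {𝓗 : Filtration ℕ mΩ}
  {q : ℕ → Ω → State N} {s0 : Ω → Fin N → ℝ} {gInit : Ω → ℝ} {r r' V : ℝ}
  {u v : ℕ → Ω → Action N}

lemma Grid.Feasible.measurable (hv : G.Feasible μ 𝓗 q s0 gInit r' v) (t : ℕ) :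
    Measurable (v t) :=
  (hv.causal t).mono (𝓗.le _) le_rfl

variable [IsProbabilityMeasure μ]

lemma Grid.Feasible.integrable_x (hv : G.Feasible μ 𝓗 q s0 gInit r' v) (t : ℕ) (i : Fin N) :
    Integrable (fun ω => (v t ω).x i) μ :=
  Integrable.of_mem_Icc (G.xMin i) (G.xMax i) ((measurable_x i).comp (hv.measurable t)).aemeasurable
    ((hv.slot t).mono fun _ h => h.charging i)

/-- The storage constraints keep the total expected charging amounts bounded. -/
lemma Grid.Feasible.abs_sum_integral_x_le (henv : G.IIDEnvironment μ 𝓗 q s0 gInit)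
    (hv : G.Feasible μ 𝓗 q s0 gInit r' v) (K : ℕ) (i : Fin N) :
    |∑ k ∈ Finset.range K, ∫ ω, (v k ω).x i ∂μ| ≤ G.sMax i - G.sMin i := by
  rw [← integral_finsetSum _ fun k _ => hv.integrable_x k i]
  have h := norm_integral_le_of_norm_le_const (μ := μ)
    (f := fun ω => ∑ k ∈ Finset.range K, (v k ω).x i) (C := G.sMax i - G.sMin i) (by
      filter_upwards [hv.energy_mem K, henv.init_energy_mem] with ω h h0
      have h1 := h i
      rw [energyState_eq_add_sum] at h1
      exact abs_le.2 ⟨by linarith [(h0 i).2, h1.1], by linarith [(h0 i).1, h1.2]⟩)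
  simpa using h

/-- The expected drift plus penalty of a slot is bounded by the long-run cost of any feasible
process. -/
lemma Grid.IsAlgorithmRun.integral_lyapunov_drift_le_of_feasible
    (henv : G.IIDEnvironment μ 𝓗 q s0 gInit) (hr : r ∈ Icc (0 : ℝ) 1) (hV : 0 < V)
    (hu : G.IsAlgorithmRun μ 𝓗 q s0 gInit r V u) (hv : G.Feasible μ 𝓗 q s0 gInit r' v)
    {g₀ : ℝ} (hg₀ : 0 ≤ g₀) (hanti : AntitoneOn G.C (Icc 0 g₀))
    (hmono : MonotoneOn G.C (Icc g₀ G.gMax)) {c : ℝ}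
    (hc : ∀ᶠ K : ℕ in atTop,
      ∑ k ∈ Finset.range K, ∫ ω, G.cost (q k ω) (v k ω) ∂μ ≤ K * c) {t : ℕ}
    (hgPrev : ∀ᵐ ω ∂μ, prevOutput (gInit ω) (fun k => u k ω) t ∈ Icc g₀ G.gMax) :
    ∫ ω, G.lyapunov V (energyState (s0 ω) (fun k => u k ω) (t + 1))
        (G.backlog (fun k => q k ω) (fun k => u k ω) (t + 1)) ∂μ
      - ∫ ω, G.lyapunov V (energyState (s0 ω) (fun k => u k ω) t)
        (G.backlog (fun k => q k ω) (fun k => u k ω) t) ∂μ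
      + V * ∫ ω, G.cost (q t ω) (u t ω) ∂μ
    ≤ V * (c + ((1 - r) * G.gMax * max G.pbMax G.dC_max + G.B / V)) := by
  set S : Ω → Fin N → ℝ := fun ω => energyState (s0 ω) (fun k => u k ω) t
  set J : Ω → ℝ := fun ω => G.backlog (fun k => q k ω) (fun k => u k ω) t
  set δ := (1 - r) * G.gMax * max G.pbMax G.dC_max
  set W : ℕ → ℝ := fun k => ∫ ω, G.cost (q k ω) (v k ω) ∂μ
  set X : ℕ → Fin N → ℝ := fun k i => ∫ ω, (v k ω).x i ∂μ with hX
  set Y : ℕ → ℝ := fun k => ∫ ω, unsatisfied (q k ω) (v k ω) ∂μ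
  set j := ∫ ω, J ω ∂μ
  have hj : 0 ≤ j := integral_nonneg_of_ae ((hu.backlog_mem henv).mono fun ω h => (h t).1)
  have hdrift := hu.integral_lyapunov_drift_le henv hV t
  set l := ∫ ω, G.lyapunov V (energyState (s0 ω) (fun k => u k ω) (t + 1))
        (G.backlog (fun k => q k ω) (fun k => u k ω) (t + 1)) ∂μ
      - ∫ ω, G.lyapunov V (energyState (s0 ω) (fun k => u k ω) t)
        (G.backlog (fun k => q k ω) (fun k => u k ω) t) ∂μ
      + V * ∫ ω, G.cost (q t ω) (u t ω) ∂μ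
  set z : Fin N → ℝ := fun i => ∫ ω, S ω i ∂μ - G.β V i
  -- The left side concerns the fixed slot `t`, while `k` is free; this permits averaging over `k`.
  have hk : ∀ k, l ≤ G.B + V * δ + V * W k + ∑ i, z i * X k i + j * (Y k - G.α) := fun k => by
    have := G.integral_driftPenalty_le hr hV hg₀ hanti hmono (henv.measurable_state t)
      (henv.measurable_state k)
      ((henv.state_identDistrib t).map_eq.trans (henv.state_identDistrib k).map_eq.symm)
      (henv.state_indep_past t) (henv.state_valid t) (henv.state_valid k)
      (measurable_energyState henv.init_energy_measurable hu.causal t)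
      (fun i => ((hu.memLp_energyState henv t i).mono_exponent (p := 1) le_top).integrable le_rfl)
      (G.measurable_backlog henv.state_measurable hu.causal t)
      (((hu.memLp_backlog henv t).mono_exponent (p := 1) le_top).integrable le_rfl) hgPrev
      (hu.solves t) (hu.integrable_driftPenalty henv hV t) (hv.measurable k) (hv.slot k)
      (hv.cost_integrable k)
    linarith
  have hsum : ∀ K : ℕ, K * l ≤ K * (G.B + V * δ) + V * ∑ k ∈ Finset.range K, W k
      + ∑ i, |z i| * (G.sMax i - G.sMin i)
      + j * (∑ k ∈ Finset.range K, Y k - K * G.α) := fun K => by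
    have h1 := Finset.sum_le_sum fun k (_ : k ∈ Finset.range K) => hk k
    have h2 : ∑ k ∈ Finset.range K, ∑ i, z i * X k i ≤ ∑ i, |z i| * (G.sMax i - G.sMin i) := by
      rw [Finset.sum_comm]
      refine Finset.sum_le_sum fun i _ => ?_
      rw [← Finset.mul_sum]
      refine (le_abs_self _).trans ?_
      rw [abs_mul]
      exact mul_le_mul_of_nonneg_left (hv.abs_sum_integral_x_le henv K i) (abs_nonneg _)
    simp only [Finset.sum_add_distrib, Finset.sum_const, Finset.card_range, nsmul_eq_mul,
      ← Finset.mul_sum, Finset.sum_sub_distrib] at h1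
    linarith
  refine le_of_forall_eventually_mul_le (a := j) (d := ∑ i, |z i| * (G.sMax i - G.sMin i)) hj
    fun ε hε => ?_
  have hq : longRunAverage Y < ((G.α + ε : ℝ) : EReal) :=
    hv.quality.trans_lt (EReal.coe_lt_coe_iff.2 (by linarith))
  filter_upwards [hc, eventually_sum_le_of_longRunAverage_lt hq] with K h1 h2
  have h3 := mul_le_mul_of_nonneg_left h1 hV.le
  have h4 : j * (∑ k ∈ Finset.range K, Y k - K * G.α) ≤ j * (K * ε) :=
    mul_le_mul_of_nonneg_left (by linarith) hj
  have h5 : V * (c + (δ + G.B / V)) = V * c + V * δ + G.B := by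
    field_simp
    ring
  rw [h5]
  linarith [hsum K]

/-- Comparison of the accumulated costs of the algorithm and of a feasible process, provided that
the output of the generator eventually stays above a minimizer of the generation cost. -/
lemma Grid.IsAlgorithmRun.exists_eventually_sum_le
    (henv : G.IIDEnvironment μ 𝓗 q s0 gInit) (hr : r ∈ Icc (0 : ℝ) 1) (hV : 0 < V)
    (hu : G.IsAlgorithmRun μ 𝓗 q s0 gInit r V u) (hv : G.Feasible μ 𝓗 q s0 gInit r' v)
    {g₀ : ℝ} (hg₀ : 0 ≤ g₀) (hanti : AntitoneOn G.C (Icc 0 g₀))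
    (hmono : MonotoneOn G.C (Icc g₀ G.gMax)) {T₀ : ℕ}
    (hgPrev : ∀ t ≥ T₀, ∀ᵐ ω ∂μ, prevOutput (gInit ω) (fun k => u k ω) t ∈ Icc g₀ G.gMax)
    {c : ℝ} (hc : ∀ᶠ K : ℕ in atTop,
      ∑ k ∈ Finset.range K, ∫ ω, G.cost (q k ω) (v k ω) ∂μ ≤ K * c) :
    ∃ A, ∀ᶠ T : ℕ in atTop, ∑ t ∈ Finset.range T, ∫ ω, G.cost (q t ω) (u t ω) ∂μ
      ≤ T * (c + ((1 - r) * G.gMax * max G.pbMax G.dC_max + G.B / V)) + A := by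
  set m := c + ((1 - r) * G.gMax * max G.pbMax G.dC_max + G.B / V) with hm
  set w : ℕ → ℝ := fun t => ∫ ω, G.cost (q t ω) (u t ω) ∂μ
  set E : ℕ → ℝ := fun t => ∫ ω, G.lyapunov V (energyState (s0 ω) (fun k => u k ω) t)
    (G.backlog (fun k => q k ω) (fun k => u k ω) t) ∂μ with hE
  have hE0 : ∀ t, 0 ≤ E t := fun t => integral_nonneg fun ω => G.lyapunov_nonneg _ _ _
  -- The constant collects the Lyapunov value at `T₀` and the excess cost of the slots before `T₀`.
  refine ⟨(E T₀ + V * (∑ t ∈ Finset.range T₀, w t - T₀ * m)) / V,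
    (eventually_ge_atTop T₀).mono fun T hT => ?_⟩
  have key : E T + V * (∑ t ∈ Finset.range T, w t - T * m)
      ≤ E T₀ + V * (∑ t ∈ Finset.range T₀, w t - T₀ * m) := by
    induction T, hT using Nat.le_induction with
    | base => exact le_rfl
    | succ t ht ih =>
      have h : E (t + 1) - E t + V * w t ≤ V * m :=
        hu.integral_lyapunov_drift_le_of_feasible henv hr hV hv hg₀ hanti hmono hc (hgPrev t ht)
      rw [Finset.sum_range_succ]
      push_cast
      linarith
  rw [← sub_le_iff_le_add', le_div_iff₀ hV]
  linarith [hE0 T]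

end Comparison

/-! ### The generator output reaches the least minimizer of its cost. -/

section Output

variable {G : Grid N} {μ : Measure Ω} {𝓗 : Filtration ℕ mΩ} {q : ℕ → Ω → State N}
  {s0 : Ω → Fin N → ℝ} {gInit : Ω → ℝ} {r V : ℝ} {u : ℕ → Ω → Action N}

lemma Grid.IsAlgorithmRun.prevOutput_mem (henv : G.IIDEnvironment μ 𝓗 q s0 gInit)
    (hu : G.IsAlgorithmRun μ 𝓗 q s0 gInit r V u) (t : ℕ) :
    ∀ᵐ ω ∂μ, prevOutput (gInit ω) (fun k => u k ω) t ∈ Icc 0 G.gMax := by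
  cases t with
  | zero => exact henv.init_output_mem
  | succ t => exact (hu.solves t).mono fun ω h => h.1.output

/-- With a positive ramping coefficient, the output of the generator reaches the least minimizer
of the generation cost after finitely many slots and stays above it. -/
lemma Grid.IsAlgorithmRun.exists_forall_le_prevOutput (henv : G.IIDEnvironment μ 𝓗 q s0 gInit)
    (hr : 0 < r) (hV : 0 < V) (hu : G.IsAlgorithmRun μ 𝓗 q s0 gInit r V u) {g₀ : ℝ}
    (hg₀ : g₀ ∈ Icc 0 G.gMax) (hC : StrictAntiOn G.C (Icc 0 g₀)) :
    ∃ T₀, ∀ t ≥ T₀, ∀ᵐ ω ∂μ, prevOutput (gInit ω) (fun k => u k ω) t ∈ Icc g₀ G.gMax := by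
  -- Below `g₀` the output climbs by at least `r gMax` per slot unless it reaches `g₀`, so `T₀ ≥ 1 /
  -- r` slots suffice, uniformly in `ω`.
  have hle : ∀ t : ℕ, ∀ᵐ ω ∂μ,
      min g₀ (t * (r * G.gMax)) ≤ prevOutput (gInit ω) (fun k => u k ω) t := fun t => by
    induction t with
    | zero =>
      filter_upwards [henv.init_output_mem] with ω h
      refine (min_le_right _ _).trans ?_
      simpa [prevOutput] using h.1
    | succ t ih =>
      filter_upwards [ih, hu.solves t, henv.state_valid t] with ω h1 h2 h3
      refine le_trans ?_ (h2.min_le_output hV h3 hg₀.2 hC)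
      have hrg : 0 ≤ r * G.gMax := mul_nonneg hr.le G.gMax_nonneg
      refine le_min (min_le_left _ _) ?_
      refine le_trans ?_ (add_le_add_left h1 (r * G.gMax))
      rw [← min_add_add_right]
      refine min_le_min (by linarith) (le_of_eq ?_)
      push_cast
      ring
  obtain ⟨T₀, hT₀⟩ := exists_nat_ge (1 / r)
  refine ⟨T₀, fun t ht => ?_⟩
  filter_upwards [hle t, hu.prevOutput_mem henv t] with ω h1 h2
  refine ⟨le_trans (le_min le_rfl (hg₀.2.trans ?_)) h1, h2.2⟩
  have h3 : 1 / r ≤ t := hT₀.trans (by exact_mod_cast ht)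
  rw [div_le_iff₀ hr] at h3
  nlinarith [G.gMax_nonneg]

end Output

/-- `g₀` is the least minimizer. Being least, it lies strictly below all values to its left, and
convexity spreads this to strict decrease. -/
lemma _root_.ConvexOn.exists_strictAntiOn_monotoneOn {f : ℝ → ℝ} {b : ℝ} (hb : 0 ≤ b)
    (hf : ConvexOn ℝ (Icc 0 b) f) (hcont : ContinuousOn f (Icc 0 b)) :
    ∃ g₀ ∈ Icc 0 b, StrictAntiOn f (Icc 0 g₀) ∧ MonotoneOn f (Icc g₀ b) := by
  obtain ⟨x₀, hx₀, hmin⟩ := isCompact_Icc.exists_isMinOn (nonempty_Icc.2 hb) hcont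
  have hS : IsCompact (Icc 0 b ∩ f ⁻¹' Iic (f x₀)) :=
    isCompact_Icc.of_isClosed_subset (hcont.preimage_isClosed_of_isClosed isClosed_Icc isClosed_Iic)
      inter_subset_left
  obtain ⟨g₀, ⟨hg₀, hle⟩, hleast⟩ := hS.exists_isLeast ⟨x₀, hx₀, mem_preimage.2 (mem_Iic.2 le_rfl)⟩
  have hlt : ∀ x ∈ Icc 0 b, x < g₀ → f g₀ < f x := fun x hx hxg => by
    by_contra! h
    exact absurd (hleast ⟨hx, h.trans hle⟩) (not_le.2 hxg)
  refine ⟨g₀, hg₀, fun x hx y hy hxy => ?_, fun x hx y hy hxy => ?_⟩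
  · have hx' : x ∈ Icc 0 b := ⟨hx.1, hx.2.trans hg₀.2⟩
    have hy' : y ∈ Icc 0 b := ⟨hy.1, hy.2.trans hg₀.2⟩
    rcases hy.2.eq_or_lt with rfl | hyg
    · exact hlt x hx' hxy
    · refine hf.lt_left_of_right_lt hx' hg₀ ?_ (hlt y hy' hyg)
      rw [openSegment_eq_Ioo (hxy.trans hyg)]
      exact ⟨hxy, hyg⟩
  · have hx' : x ∈ Icc 0 b := ⟨hg₀.1.trans hx.1, hx.2⟩
    have hy' : y ∈ Icc 0 b := ⟨hg₀.1.trans hy.1, hy.2⟩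
    rcases hxy.eq_or_lt with rfl | hxy'
    · exact le_rfl
    rcases hx.1.eq_or_lt with rfl | hxg
    · exact hle.trans (hmin hy')
    · refine hf.le_right_of_left_le hg₀ hy' ?_ (hle.trans (hmin hx'))
      rw [openSegment_eq_Ioo (hxg.trans hxy')]
      exact ⟨hxg, hxy'⟩

/-! ### No ramping: removing the generation cost. -/

/-- The grid whose generation is free of charge. -/
noncomputable def Grid.freeGeneration (G : Grid N) : Grid N :=
  { G with
    C := fun _ => 0
    C_contDiff := contDiffOn_const
    C_convex := convexOn_const 0 (convex_Icc _ _)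
    dC_max := 0
    dC_le := fun g _ => by simp }

lemma Grid.freeGeneration_slotFeasible_iff {G : Grid N} {r gPrev : ℝ} {q : State N}
    {u : Action N} :
    G.freeGeneration.SlotFeasible r q gPrev u ↔ G.SlotFeasible r q gPrev u :=
  ⟨fun h => ⟨h.1, h.2, h.3, h.4, h.5, h.6, h.7, h.8⟩,
    fun h => ⟨h.1, h.2, h.3, h.4, h.5, h.6, h.7, h.8⟩⟩

lemma Grid.cost_eq_freeGeneration (G : Grid N) (q : State N) (u : Action N) :
    G.cost q u = G.freeGeneration.cost q u + G.C u.g := by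
  simp only [Grid.cost, Grid.freeGeneration]
  ring

lemma Grid.slotObjective_eq_freeGeneration (G : Grid N) (V : ℝ) (s : Fin N → ℝ) (J : ℝ)
    (q : State N) (u : Action N) :
    G.slotObjective V s J q u = G.freeGeneration.slotObjective V s J q u + V * G.C u.g := by
  simp only [Grid.slotObjective, Grid.freeGeneration, Grid.β]
  ring

lemma Grid.freeGeneration_backlog (G : Grid N) (q : ℕ → State N) (u : ℕ → Action N) (t : ℕ) :
    G.freeGeneration.backlog q u t = G.backlog q u t := by
  induction t with
  | zero => rfl
  | succ t ih => rw [Grid.backlog, Grid.backlog, ih]; rfl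

section FreeGeneration

variable {G : Grid N} {μ : Measure Ω} {𝓗 : Filtration ℕ mΩ} {q : ℕ → Ω → State N}
  {s0 : Ω → Fin N → ℝ} {gInit : Ω → ℝ} {r V : ℝ} {u : ℕ → Ω → Action N}

lemma Grid.IIDEnvironment.freeGeneration (henv : G.IIDEnvironment μ 𝓗 q s0 gInit) :
    G.freeGeneration.IIDEnvironment μ 𝓗 q s0 gInit where
  state_measurable := henv.state_measurable
  state_valid t := (henv.state_valid t).mono fun _ h => ⟨h.1, h.2, h.3, h.4, h.5, h.6, h.7⟩
  state_iIndep := henv.state_iIndep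
  state_identDistrib := henv.state_identDistrib
  state_indep_past := henv.state_indep_past
  init_energy_measurable := henv.init_energy_measurable
  init_energy_mem := henv.init_energy_mem
  init_output_measurable := henv.init_output_measurable
  init_output_mem := henv.init_output_mem

lemma Grid.SlotFeasible.output_eq {q : State N} {gPrev : ℝ} {u : Action N}
    (h : G.SlotFeasible 0 q gPrev u) : u.g = gPrev := by
  have := h.ramping
  rw [zero_mul] at this
  exact sub_eq_zero.1 (abs_nonpos_iff.1 this)

lemma ae_output_eq_of_slotFeasible (h : ∀ t, ∀ᵐ ω ∂μ,
      G.SlotFeasible 0 (q t ω) (prevOutput (gInit ω) (fun k => u k ω) t) (u t ω)) (t : ℕ) :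
    ∀ᵐ ω ∂μ, (u t ω).g = gInit ω := by
  induction t with
  | zero => exact (h 0).mono fun ω h => h.output_eq
  | succ t ih =>
    filter_upwards [ih, h (t + 1)] with ω h1 h2
    exact h2.output_eq.trans h1

/-- With `r = 0` every competing action has the same output, so the generation cost shifts the
objective by a constant and leaves the minimizers unchanged. -/
lemma Grid.IsAlgorithmRun.freeGeneration (hu : G.IsAlgorithmRun μ 𝓗 q s0 gInit 0 V u) :
    G.freeGeneration.IsAlgorithmRun μ 𝓗 q s0 gInit 0 V u where
  causal := hu.causal
  solves t := by
    filter_upwards [hu.solves t] with ω h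
    refine ⟨freeGeneration_slotFeasible_iff.2 h.1, fun u' hu' => ?_⟩
    have h1 := h.2 u' (freeGeneration_slotFeasible_iff.1 hu')
    rw [G.slotObjective_eq_freeGeneration, G.slotObjective_eq_freeGeneration, h.1.output_eq,
      (freeGeneration_slotFeasible_iff.1 hu').output_eq] at h1
    rw [G.freeGeneration_backlog]
    linarith

variable [IsProbabilityMeasure μ]

lemma Grid.IIDEnvironment.integrable_C_gInit (henv : G.IIDEnvironment μ 𝓗 q s0 gInit) :
    Integrable (fun ω => G.C (gInit ω)) μ := by
  obtain ⟨M, hM⟩ := isCompact_Icc.exists_bound_of_continuousOn G.C_contDiff.continuousOn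
  have hC : Continuous fun g => G.C (max 0 (min g G.gMax)) :=
    G.C_contDiff.continuousOn.comp_continuous (by fun_prop) fun g =>
      ⟨le_max_left _ _, max_le G.gMax_nonneg (min_le_right _ _)⟩
  have hm : Measurable gInit := henv.init_output_measurable.mono (𝓗.le 0) le_rfl
  refine Integrable.of_bound ((hC.measurable.comp hm).aestronglyMeasurable.congr ?_) M
    (henv.init_output_mem.mono fun ω h => hM _ h)
  filter_upwards [henv.init_output_mem] with ω h
  simp only [Function.comp_apply]
  rw [min_eq_left h.2, max_eq_right h.1]

lemma Grid.Feasible.freeGeneration {v : ℕ → Ω → Action N}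
    (henv : G.IIDEnvironment μ 𝓗 q s0 gInit) (hv : G.Feasible μ 𝓗 q s0 gInit 0 v) :
    G.freeGeneration.Feasible μ 𝓗 q s0 gInit 0 v where
  causal := hv.causal
  cost_integrable t := by
    refine ((hv.cost_integrable t).sub henv.integrable_C_gInit).congr ?_
    filter_upwards [ae_output_eq_of_slotFeasible hv.slot t] with ω h
    rw [Pi.sub_apply, G.cost_eq_freeGeneration, h, add_sub_cancel_right]
  slot t := (hv.slot t).mono fun ω h => freeGeneration_slotFeasible_iff.2 h
  energy_mem := hv.energy_mem
  quality := hv.quality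

lemma Grid.IIDEnvironment.integral_cost_eq_freeGeneration
    (henv : G.IIDEnvironment μ 𝓗 q s0 gInit) {v : Ω → Action N} {t : ℕ}
    (hi : Integrable (fun ω => G.freeGeneration.cost (q t ω) (v ω)) μ)
    (hv : ∀ᵐ ω ∂μ, (v ω).g = gInit ω) :
    ∫ ω, G.cost (q t ω) (v ω) ∂μ
      = ∫ ω, G.freeGeneration.cost (q t ω) (v ω) ∂μ + ∫ ω, G.C (gInit ω) ∂μ := by
  rw [← integral_add hi henv.integrable_C_gInit]
  refine integral_congr_ae (hv.mono fun ω h => ?_)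
  simp only [← h]
  exact G.cost_eq_freeGeneration _ _

end FreeGeneration

/-! ### The bound on long-run costs. -/

section Main

variable {G : Grid N} {μ : Measure Ω} [IsProbabilityMeasure μ] {𝓗 : Filtration ℕ mΩ}
  {q : ℕ → Ω → State N} {s0 : Ω → Fin N → ℝ} {gInit : Ω → ℝ} {r r' V : ℝ}
  {u v : ℕ → Ω → Action N}

/-- Testing against real `c` above the right side also covers infinite averages. -/
lemma longRunAverage_le_of_forall_exists {f g : ℕ → ℝ} {d : ℝ}
    (h : ∀ c : ℝ, (∀ᶠ K : ℕ in atTop, ∑ k ∈ Finset.range K, g k ≤ K * c) →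
      ∃ A, ∀ᶠ T : ℕ in atTop, ∑ t ∈ Finset.range T, f t ≤ T * (c + d) + A) :
    longRunAverage f - (d : EReal) ≤ longRunAverage g := by
  refine EReal.le_of_forall_lt_iff_le.1 fun c hc => ?_
  obtain ⟨A, hA⟩ := h c (eventually_sum_le_of_longRunAverage_lt hc)
  have := longRunAverage_le_of_eventually_sum_le hA
  rw [EReal.coe_add] at this
  exact EReal.sub_le_of_le_add this

/-- If the generator can be ramped, or if `r = r' = 0`, then the long-run cost of the algorithm
exceeds that of a feasible process by a bounded amount only. -/
lemma Grid.IsAlgorithmRun.longRunCost_sub_le (henv : G.IIDEnvironment μ 𝓗 q s0 gInit)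
    (hr : r ∈ Icc (0 : ℝ) 1) (hrr : 0 < r ∨ r' = 0) (hV : 0 < V)
    (hu : G.IsAlgorithmRun μ 𝓗 q s0 gInit r V u) (hv : G.Feasible μ 𝓗 q s0 gInit r' v) :
    G.longRunCost μ q u
        - (((1 - r) * G.gMax * max G.pbMax G.dC_max + G.B / V : ℝ) : EReal)
      ≤ G.longRunCost μ q v := by
  refine longRunAverage_le_of_forall_exists fun c hc => ?_
  rcases hr.1.lt_or_eq with h0 | rfl
  · obtain ⟨g₀, hg₀, hanti, hmono⟩ := G.C_convex.exists_strictAntiOn_monotoneOn G.gMax_nonneg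
      G.C_contDiff.continuousOn
    obtain ⟨T₀, hT₀⟩ := hu.exists_forall_le_prevOutput henv h0 hV hg₀ hanti
    exact hu.exists_eventually_sum_le henv hr hV hv hg₀.1 hanti.antitoneOn hmono hT₀ hc
  · obtain rfl : r' = 0 := hrr.resolve_left (lt_irrefl 0)
    have henv' := henv.freeGeneration
    have hu' := hu.freeGeneration
    have hv' := hv.freeGeneration henv
    set κ := ∫ ω, G.C (gInit ω) ∂μ with hκ
    have eu := fun t => henv.integral_cost_eq_freeGeneration (t := t)
      (hu'.integrable_cost henv' hV t)
      (ae_output_eq_of_slotFeasible (fun t => (hu.solves t).mono fun ω h => h.1) t)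
    have ev := fun t => henv.integral_cost_eq_freeGeneration (t := t) (hv'.cost_integrable t)
      (ae_output_eq_of_slotFeasible hv.slot t)
    simp only [eu, ev, Finset.sum_add_distrib, Finset.sum_const, Finset.card_range,
      nsmul_eq_mul] at hc ⊢
    -- The zero cost is minimized at `0`, so every output is admissible from slot `0` on.
    obtain ⟨A, hA⟩ := hu'.exists_eventually_sum_le henv' hr hV hv' (g₀ := 0) le_rfl
      (fun _ _ _ _ _ => le_rfl) (fun _ _ _ _ _ => le_rfl) (T₀ := 0)
      (fun t _ => hu'.prevOutput_mem henv' t) (c := c - κ) (hc.mono fun K hK => by linarith)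
    obtain ⟨ω, hω⟩ := (henv.state_valid 0).exists
    have hpb : 0 ≤ G.pbMax := hω.pb_pos.le.trans hω.pb_mem.2
    -- The free grid has derivative bound `0`; as prices are nonnegative, its bound is no larger
    -- even if `dC_max < 0`.
    have hmax : max G.pbMax 0 ≤ max G.pbMax G.dC_max :=
      max_le (le_max_left _ _) (hpb.trans (le_max_left _ _))
    refine ⟨A, hA.mono fun T hT => ?_⟩
    have h1 : (T : ℝ) * (G.gMax * max G.pbMax 0) ≤ T * (G.gMax * max G.pbMax G.dC_max) :=
      mul_le_mul_of_nonneg_left (mul_le_mul_of_nonneg_left hmax G.gMax_nonneg) T.cast_nonneg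
    have h2 : ∑ t ∈ Finset.range T, ∫ ω, G.freeGeneration.cost (q t ω) (u t ω) ∂μ
      ≤ T * (c - κ + ((1 - 0) * G.gMax * max G.pbMax 0 + G.B / V)) + A := hT
    linarith

end Main

end PowerGrid

theorem theorem1 {N : ℕ} (G : PowerGrid.Grid N)
    {Ω : Type*} [mΩ : MeasurableSpace Ω] (μ : Measure Ω) [IsProbabilityMeasure μ]
    (𝓗 : Filtration ℕ mΩ) (q : ℕ → Ω → PowerGrid.State N)
    (s0 : Ω → Fin N → ℝ) (gInit : Ω → ℝ)
    (henv : G.IIDEnvironment μ 𝓗 q s0 gInit)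
    (r : ℝ) (hr : r ∈ Icc (0 : ℝ) 1) (V : ℝ) (hV : 0 < V) :
    (∀ u : ℕ → Ω → PowerGrid.Action N, G.IsAlgorithmRun μ 𝓗 q s0 gInit r V u →
      G.longRunCost μ q u ≤ G.optCost μ 𝓗 q s0 gInit r
        + (((1 - r) * G.gMax * max G.pbMax G.dC_max + G.B / V : ℝ) : EReal)) ∧
    (∀ u : ℕ → Ω → PowerGrid.Action N, G.IsAlgorithmRun μ 𝓗 q s0 gInit 1 V u →
      G.longRunCost μ q u - ((G.B / V : ℝ) : EReal) ≤ G.optCost μ 𝓗 q s0 gInit r) := by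
  refine ⟨fun u hu => ?_, fun u hu => ?_⟩
  · rw [← EReal.sub_le_iff_le_add (Or.inl (EReal.coe_ne_bot _)) (Or.inl (EReal.coe_ne_top _))]
    exact le_iInf₂ fun v hv => hu.longRunCost_sub_le henv hr
      (hr.1.lt_or_eq.imp id Eq.symm) hV hv
  · refine le_iInf₂ fun v hv => ?_
    -- The competitor may have any ramping coefficient; at coefficient `1` for the algorithm the
    -- ramping term vanishes.
    have := hu.longRunCost_sub_le henv ⟨zero_le_one, le_rfl⟩ (Or.inl one_pos) hV hv
    simpa using this
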